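/- Let $n\ge 1$ and let $1<p<q$ be real numbers. A convex body in $\mathbb{R}^n$ is a compact convex set with non-empty interior; it is centered if $\mathbb{E}[X]=0$, where $X$ is uniformly distributed on it. A cone is a set of the form $K=\mathrm{conv}(B\cup\{v\})$, where $B$ is a subset of an affine hyperplane $H\subset\mathbb{R}^n$ and $v\notin H$; such a set $B$ is called a base of $K$. For a centered convex body $K\subset\mathbb{R}^n$ and $X\sim\mathrm{Uni}(K)$ put $$\alpha^*(K):=\max_{\theta\in S^{n-1}}\frac{\bigl|\mathbb{E}\bigl[|X\cdot\theta|^{q}\,\mathrm{sgn}(X\cdot\theta)\bigr]\bigr|^{1/q}}{\|X\cdot\theta\|_{p}},\qquad \|X\cdot\theta\|_p=\bigl(\mathbb{E}|X\cdot\theta|^p\bigr)^{1/p},$$ where $S^{n-1}$ is the Euclidean unit sphere. Let $\Delta_n\subset\mathbb{R}^n$ be any centered $n$-dimensional simplex. Then for every centered convex body $K\subset\mathbb{R}^n$ the maximum defining $\alpha^*(K)$ is attained, and $$\alpha^*(K)\le\alpha^*(\Delta_n),$$ with equality if and only if $K$ is a cone. Moreover, if $K$ is a cone, then every $\theta\in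 S^{n-1}$ at which the maximum defining $\alpha^*(K)$ is attained is normal to a base of $K$. -/

import Mathlib

open MeasureTheory

noncomputable section

/-- The uniform probability measure on a set `K ⊆ ℝⁿ`, i.e. the law of `X ∼ Uni(K)`. -/
def unif {n : ℕ} (K : Set (EuclideanSpace ℝ (Fin n))) : Measure (EuclideanSpace ℝ (Fin n)) :=
  ProbabilityTheory.cond volume K

/-- `K` is centered: `E[X] = 0` for `X ∼ Uni(K)`. -/
def IsCentered {n : ℕ} (K : Set (EuclideanSpace ℝ (Fin n))) : Prop :=
  ∫ x, x ∂(unif K) = 0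

/-- A convex body: a convex compact set with non-empty interior. -/
structure IsConvexBody {n : ℕ} (K : Set (EuclideanSpace ℝ (Fin n))) : Prop where
  convex : Convex ℝ K
  isCompact : IsCompact K
  interior_nonempty : (interior K).Nonempty

/-- An `n`-dimensional simplex in `ℝⁿ`: the convex hull of `n + 1` affinely independent points. -/
def IsSimplex {n : ℕ} (D : Set (EuclideanSpace ℝ (Fin n))) : Prop :=
  ∃ S : Affine.Simplex ℝ (EuclideanSpace ℝ (Fin n)) n, D = convexHull ℝ (Set.range S.points)

/-- `E[|X·θ|^q sgn(X·θ)]` for `X ∼ Uni(K)`. -/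
def signedMoment {n : ℕ} (q : ℝ) (K : Set (EuclideanSpace ℝ (Fin n)))
    (θ : EuclideanSpace ℝ (Fin n)) : ℝ :=
  ∫ x, |inner ℝ x θ| ^ q * Real.sign (inner ℝ x θ) ∂(unif K)

/-- `‖X·θ‖_p = (E[|X·θ|^p])^(1/p)` for `X ∼ Uni(K)`. -/
def marginalNorm {n : ℕ} (p : ℝ) (K : Set (EuclideanSpace ℝ (Fin n)))
    (θ : EuclideanSpace ℝ (Fin n)) : ℝ :=
  (∫ x, |inner ℝ x θ| ^ p ∂(unif K)) ^ (1 / p)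

/-- `|E[|X·θ|^q sgn(X·θ)]|^(1/q) / ‖X·θ‖_p` for `X ∼ Uni(K)`. -/
def asymRatio {n : ℕ} (p q : ℝ) (K : Set (EuclideanSpace ℝ (Fin n)))
    (θ : EuclideanSpace ℝ (Fin n)) : ℝ :=
  |signedMoment q K θ| ^ (1 / q) / marginalNorm p K θ

/-- `α*(K)`, the supremum of `asymRatio` over the unit sphere. -/
def alphaStar {n : ℕ} (p q : ℝ) (K : Set (EuclideanSpace ℝ (Fin n))) : ℝ :=
  sSup (asymRatio p q K '' Metric.sphere 0 1)

/-- `K` is a cone with base `B`: `B` lies in an affine hyperplane `H`, and `K` is the convex hull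
of `B` and a point `v` outside `H`. -/
def IsConeWithBase {n : ℕ} (K B : Set (EuclideanSpace ℝ (Fin n))) : Prop :=
  ∃ (H : AffineSubspace ℝ (EuclideanSpace ℝ (Fin n))) (v : EuclideanSpace ℝ (Fin n)),
    (H : Set (EuclideanSpace ℝ (Fin n))).Nonempty ∧
    Module.finrank ℝ H.direction + 1 = n ∧
    B ⊆ (H : Set (EuclideanSpace ℝ (Fin n))) ∧ v ∉ H ∧
    K = convexHull ℝ (insert v B)

/-- `K` is a cone. -/
def IsCone {n : ℕ} (K : Set (EuclideanSpace ℝ (Fin n))) : Prop :=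
  ∃ B, IsConeWithBase K B

/-- `θ` is normal to `B`: it is orthogonal to all differences of points of `B`. -/
def IsNormalTo {n : ℕ} (θ : EuclideanSpace ℝ (Fin n)) (B : Set (EuclideanSpace ℝ (Fin n))) :
    Prop :=
  θ ∈ (vectorSpan ℝ B)ᗮ

end

open MeasureTheory
open scoped Pointwise

/-! Everything is reduced to the one-dimensional law of `X·θ`, encoded by `tail K θ t = P(X·θ ≥ t)`.
For a cone with `θ` normal to its base, the caps are homothetic copies of the cone about its apex,
so the tail is `((b - t)/(b - a))^n` between base and apex (`coneTail`); in particular only the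
dimension and the two heights matter, not the base.

Let `D` be the tail of an arbitrary body minus such a cone tail. Brunn–Minkowski forces the levels
below `b` at which `D ≥ 0` and `t ≥ a` to form an interval, so `D` has sign pattern `-, +, -`
(`IsConvexBody.exists_sign_pattern`). By layer-cake integration, centering gives `∫ D = 0`;
rescaling `θ` so that the `p`-th absolute moments agree gives `∫ |t|^(p-2) t D = 0`; and the
difference of signed `q`-th moments is `q ∫ |t|^(q-1) D`. Since `1`, `|t|^(p-2) t`, `|t|^(q-1)` form
a Chebyshev system, subtracting a combination of the first two from the third gives a function that
changes sign exactly where `D` does, with the opposite signs. Hence the last integral is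
nonpositive, and it vanishes only if `D` does (`integral_abs_rpow_mul_le_zero`,
`IsConvexBody.signedMoment_le`).

Equality therefore makes the tail of the body a cone tail. Comparing volumes of caps with homothetic
copies of the body then shows that the body is a cone with base normal to `θ`
(`IsConvexBody.exists_isConeWithBase_of_tail_eq`). A simplex is a cone, and two cones compared in
both directions have the same `α*`. -/

/-! ### Brunn–Minkowski on the line. -/

theorem mul_volume_add_le_of_isCompact {S : Set ℝ} (hS : MeasurableSet S) (hS0 : S.Nonempty)
    {α β w : ENNReal}
    (h : ∀ E ⊆ S, IsCompact E → E.Nonempty → α * volume E + β ≤ w) : α * volume S + β ≤ w := by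
  obtain ⟨s, hs⟩ := hS0
  -- Inner regularity also runs over the empty compact set; inserting a point of `S` makes every
  -- competitor nonempty without decreasing its volume.
  have h' : ∀ E ⊆ S, IsCompact E → α * volume E + β ≤ w := fun E hE hEc =>
    le_trans (by gcongr; exact Set.subset_insert s E)
      (h (insert s E) (Set.insert_subset hs hE) (hEc.insert s) (Set.insert_nonempty _ _))
  have hβ : β ≤ w := by simpa using h' ∅ (Set.empty_subset _) isCompact_empty
  rw [hS.measure_eq_iSup_isCompact, ENNReal.mul_iSup, ENNReal.iSup_add]
  refine iSup_le fun E => ?_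
  by_cases hES : E ⊆ S
  · by_cases hE : IsCompact E
    · simpa [hES, hE] using h' E hES hE
    · simpa [hES, hE] using hβ
  · simpa [hES] using hβ

theorem volume_image_affine (c d : ℝ) (S : Set ℝ) (hc : 0 < c) :
    volume ((fun x => c * x + d) '' S) = ENNReal.ofReal c * volume S := by
  have : (fun x => c * x + d) '' S = (fun x => x + d) '' (c • S) := by
    rw [← Set.image_smul, Set.image_image]; rfl
  rw [this, Set.image_add_right, measure_preimage_add_right, Measure.addHaar_smul]
  simp [abs_of_pos hc]

/-- Gluing the scaled copy of `E` to the minimum of `F` and the scaled copy of `F` to the maximum of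
`E` puts two sets in `W` that meet in at most one point, so their volumes add. -/
theorem volume_combo_ge_of_isCompact {E F W : Set ℝ} (hE : IsCompact E) (hF : IsCompact F)
    (hE0 : E.Nonempty) (hF0 : F.Nonempty) {l : ℝ} (hl0 : 0 < l) (hl1 : l < 1)
    (h : ∀ x ∈ E, ∀ y ∈ F, (1 - l) * x + l * y ∈ W) :
    ENNReal.ofReal (1 - l) * volume E + ENNReal.ofReal l * volume F ≤ volume W := by
  obtain ⟨e, heE, he⟩ := hE.exists_isGreatest hE0
  obtain ⟨f, hfF, hf⟩ := hF.exists_isLeast hF0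
  rw [← volume_image_affine (1 - l) (l * f) E (by linarith),
    ← volume_image_affine l ((1 - l) * e) F hl0]
  have hd : (volume : Measure ℝ) (((fun x => (1 - l) * x + l * f) '' E) ∩
      ((fun x => l * x + (1 - l) * e) '' F)) = 0 := by
    refine measure_mono_null (t := {(1 - l) * e + l * f}) ?_ (by simp)
    rintro z ⟨⟨x, hx, rfl⟩, ⟨y, hy, hxy⟩⟩
    have h1 := he hx
    have h2 := hf hy
    simp only at hxy
    rw [Set.mem_singleton_iff]
    simp only
    nlinarith [mul_le_mul_of_nonneg_left h1 (by linarith : 0 ≤ 1 - l),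
      mul_le_mul_of_nonneg_left h2 hl0.le]
  have hm : MeasurableSet ((fun x => l * x + (1 - l) * e) '' F) :=
    (hF.image (by fun_prop)).measurableSet
  rw [← measure_union₀ hm.nullMeasurableSet hd]
  refine measure_mono ?_
  rintro z (⟨x, hx, rfl⟩ | ⟨y, hy, rfl⟩)
  · exact h x hx f hfF
  · simpa [add_comm] using h e heE y hy

/-- One-dimensional Brunn–Minkowski inequality. -/
theorem volume_combo_ge {A B W : Set ℝ} (hA : MeasurableSet A) (hB : MeasurableSet B)
    (hA0 : A.Nonempty) (hB0 : B.Nonempty) {l : ℝ} (hl0 : 0 < l) (hl1 : l < 1)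
    (h : ∀ x ∈ A, ∀ y ∈ B, (1 - l) * x + l * y ∈ W) :
    ENNReal.ofReal (1 - l) * volume A + ENNReal.ofReal l * volume B ≤ volume W := by
  refine mul_volume_add_le_of_isCompact hA hA0 fun E hEA hE hE0 => ?_
  rw [add_comm]
  refine mul_volume_add_le_of_isCompact hB hB0 fun F hFB hF hF0 => ?_
  rw [add_comm]
  exact volume_combo_ge_of_isCompact hE hF hE0 hF0 hl0 hl1
    fun x hx y hy => h x (hEA hx) y (hFB hy)

/-! ### Prékopa–Leindler and Brunn–Minkowski in `ℝⁿ`. -/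

/-- Prékopa–Leindler on the line for functions with supremum one. -/
theorem lintegral_combo_le {f g h : ℝ → ℝ} (hf : Measurable f) (hg : Measurable g)
    (hh : Measurable h) (hf0 : ∀ x, 0 ≤ f x) (hg0 : ∀ x, 0 ≤ g x) (hh0 : ∀ x, 0 ≤ h x)
    (hf1 : ∀ x, f x ≤ 1) (hg1 : ∀ x, g x ≤ 1) (hfs : ∀ t < 1, ∃ x, t < f x)
    (hgs : ∀ t < 1, ∃ x, t < g x) {l : ℝ} (hl0 : 0 < l) (hl1 : l < 1)
    (hfgh : ∀ x y, f x ^ (1 - l) * g y ^ l ≤ h ((1 - l) * x + l * y)) :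
    ENNReal.ofReal (1 - l) * (∫⁻ x, ENNReal.ofReal (f x)) +
      ENNReal.ofReal l * (∫⁻ x, ENNReal.ofReal (g x)) ≤ ∫⁻ x, ENNReal.ofReal (h x) := by
  -- Only levels in `(0, 1)` contribute. There the superlevel sets of both functions are nonempty,
  -- as the one-dimensional Brunn–Minkowski inequality requires.
  have cut : ∀ f : ℝ → ℝ, Measurable f → (∀ x, 0 ≤ f x) → (∀ x, f x ≤ 1) →
      ∫⁻ x, ENNReal.ofReal (f x) = ∫⁻ t in Set.Ioo (0 : ℝ) 1, volume {x | t < f x} := by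
    intro f hf hf0 hf1
    rw [lintegral_eq_lintegral_meas_lt volume (Filter.Eventually.of_forall hf0) hf.aemeasurable,
      ← Set.Ioo_union_Ici_eq_Ioi (zero_lt_one' ℝ),
      lintegral_union measurableSet_Ici (Set.disjoint_left.2 fun x hx hx' => not_le.2 hx.2 hx')]
    rw [setLIntegral_congr_fun (g := fun _ => 0) measurableSet_Ici]
    · simp
    · intro t ht
      have : {x | t < f x} = ∅ := by
        ext x; simpa using (hf1 x).trans ht
      simp [this]
  have hmeas : ∀ f : ℝ → ℝ, Measurable (fun t : ℝ => volume {x | t < f x}) := fun f =>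
    Antitone.measurable fun s t hst => measure_mono fun x hx => lt_of_le_of_lt hst hx
  rw [cut f hf hf0 hf1, cut g hg hg0 hg1,
    lintegral_eq_lintegral_meas_lt volume (Filter.Eventually.of_forall hh0) hh.aemeasurable,
    ← lintegral_const_mul _ (hmeas f), ← lintegral_const_mul _ (hmeas g),
    ← lintegral_add_left ((hmeas f).const_mul _)]
  refine le_trans ?_ (lintegral_mono_set (Set.Ioo_subset_Ioi_self : Set.Ioo (0 : ℝ) 1 ⊆ _))
  refine setLIntegral_mono_ae' measurableSet_Ioo (Filter.Eventually.of_forall fun t ht => ?_)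
  refine volume_combo_ge (measurableSet_lt measurable_const hf)
    (measurableSet_lt measurable_const hg) (hfs t ht.2) (hgs t ht.2) hl0 hl1 ?_
  intro x hx y hy
  refine lt_of_lt_of_le ?_ (hfgh x y)
  have h1 : t ^ (1 - l) < f x ^ (1 - l) := Real.rpow_lt_rpow ht.1.le hx (by linarith)
  have h2 : t ^ l < g y ^ l := Real.rpow_lt_rpow ht.1.le hy hl0
  calc t = t ^ (1 - l) * t ^ l := by rw [← Real.rpow_add ht.1]; simp
    _ < _ := mul_lt_mul'' h1 h2 (Real.rpow_nonneg ht.1.le _) (Real.rpow_nonneg ht.1.le _)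

/-- Prékopa–Leindler on the line for bounded functions. -/
theorem integral_rpow_mul_le {f g h : ℝ → ℝ} (hf : Measurable f) (hg : Measurable g)
    (hh : Measurable h) (hf0 : ∀ x, 0 ≤ f x) (hg0 : ∀ x, 0 ≤ g x) (hh0 : ∀ x, 0 ≤ h x)
    (hfi : Integrable f) (hgi : Integrable g) (hhi : Integrable h)
    (hfb : BddAbove (Set.range f)) (hgb : BddAbove (Set.range g)) {l : ℝ} (hl0 : 0 < l) (hl1 : l < 1)
    (hfgh : ∀ x y, f x ^ (1 - l) * g y ^ l ≤ h ((1 - l) * x + l * y)) :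
    (∫ x, f x) ^ (1 - l) * (∫ x, g x) ^ l ≤ ∫ x, h x := by
  have hhI : 0 ≤ ∫ x, h x := integral_nonneg hh0
  have hl1' : 0 < 1 - l := by linarith
  by_cases hfz : ∀ x, f x = 0
  · simp [hfz, Real.zero_rpow hl1'.ne', hhI]
  by_cases hgz : ∀ x, g x = 0
  · simp [hgz, Real.zero_rpow hl0.ne', hhI]
  push Not at hfz hgz
  have norm : ∀ f : ℝ → ℝ, (∀ x, 0 ≤ f x) → BddAbove (Set.range f) → (∃ x, f x ≠ 0) →
      ∃ a > 0, (∀ x, f x / a ≤ 1) ∧ ∀ t < 1, ∃ x, t < f x / a := by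
    rintro f hf0 hfb ⟨x, hx⟩
    have ha : 0 < ⨆ x, f x := lt_of_lt_of_le ((hf0 x).lt_of_ne' hx) (le_ciSup hfb x)
    refine ⟨⨆ x, f x, ha, fun y => (div_le_one ha).2 (le_ciSup hfb y), fun t ht => ?_⟩
    obtain ⟨y, hy⟩ := exists_lt_of_lt_ciSup (mul_lt_of_lt_one_left ha ht)
    exact ⟨y, (lt_div_iff₀ ha).2 hy⟩
  obtain ⟨a, ha, hfa, hfs⟩ := norm f hf0 hfb hfz
  obtain ⟨b, hb, hgb', hgs⟩ := norm g hg0 hgb hgz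
  set c := a ^ (1 - l) * b ^ l with hc
  have hc0 : 0 < c := by positivity
  have main := lintegral_combo_le (hf.div_const a) (hg.div_const b) (hh.div_const c)
    (fun x => div_nonneg (hf0 x) ha.le) (fun x => div_nonneg (hg0 x) hb.le)
    (fun x => div_nonneg (hh0 x) hc0.le) hfa hgb' hfs hgs hl0 hl1 (by
      intro x y
      rw [Real.div_rpow (hf0 x) ha.le, Real.div_rpow (hg0 y) hb.le, div_mul_div_comm]
      exact div_le_div_of_nonneg_right (hfgh x y) hc0.le)
  have conv : ∀ (f : ℝ → ℝ) (a : ℝ), (∀ x, 0 ≤ f x) → Integrable f → 0 < a →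
      ∫⁻ x, ENNReal.ofReal (f x / a) = ENNReal.ofReal ((∫ x, f x) / a) := by
    intro f a hf0 hfi ha
    rw [← integral_div, ofReal_integral_eq_lintegral_ofReal (hfi.div_const a)
      (Filter.Eventually.of_forall fun x => div_nonneg (hf0 x) ha.le)]
  rw [conv f a hf0 hfi ha, conv g b hg0 hgi hb, conv h c hh0 hhi hc0] at main
  have hF : 0 ≤ (∫ x, f x) / a := div_nonneg (integral_nonneg hf0) ha.le
  have hG : 0 ≤ (∫ x, g x) / b := div_nonneg (integral_nonneg hg0) hb.le
  rw [← ENNReal.ofReal_mul hl1'.le, ← ENNReal.ofReal_mul hl0.le,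
    ← ENNReal.ofReal_add (mul_nonneg hl1'.le hF) (mul_nonneg hl0.le hG),
    ENNReal.ofReal_le_ofReal_iff (div_nonneg hhI hc0.le)] at main
  -- Normalizing by the suprema gave an arithmetic-mean bound; after passing to the geometric mean,
  -- the normalizing constant `c` cancels from both sides.
  have amgm := (Real.geom_mean_le_arith_mean2_weighted hl1'.le hl0.le hF hG (by ring)).trans main
  rw [Real.div_rpow (integral_nonneg hf0) ha.le, Real.div_rpow (integral_nonneg hg0) hb.le,
    div_mul_div_comm] at amgm
  exact (div_le_div_iff_of_pos_right hc0).1 amgm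

theorem setOf_cons_mem_subset_closedBall {n : ℕ} {A : Set (Fin (n + 1) → ℝ)} {R : ℝ}
    (hR : A ⊆ Metric.closedBall 0 R) (x : ℝ) :
    {y | (Fin.cons x y : Fin (n + 1) → ℝ) ∈ A} ⊆ Metric.closedBall (0 : Fin n → ℝ) R := by
  intro y hy
  have h1 := hR hy
  rw [mem_closedBall_zero_iff] at h1 ⊢
  have hR0 : 0 ≤ R := (norm_nonneg _).trans h1
  rw [pi_norm_le_iff_of_nonneg hR0] at h1 ⊢
  intro i
  simpa using h1 i.succ

/-- Fubini along the first coordinate. The regularity of the slice volumes is what the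
one-dimensional Prékopa–Leindler inequality needs in the induction on dimension. -/
theorem volume_real_eq_integral_cons {n : ℕ} {A : Set (Fin (n + 1) → ℝ)} (hA : MeasurableSet A)
    (hAb : Bornology.IsBounded A) :
    let s : ℝ → ℝ := fun x => (volume : Measure (Fin n → ℝ)).real
      {y | (Fin.cons x y : Fin (n + 1) → ℝ) ∈ A}
    Measurable s ∧ Integrable s ∧ BddAbove (Set.range s) ∧
      (volume : Measure (Fin (n + 1) → ℝ)).real A = ∫ x, s x := by
  intro s
  let e := MeasurableEquiv.piFinSuccAbove (fun _ : Fin (n + 1) => ℝ) 0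
  have he := volume_preserving_piFinSuccAbove (fun _ : Fin (n + 1) => ℝ) 0
  have hes : ∀ z, e.symm z = (Fin.cons z.1 z.2 : Fin (n + 1) → ℝ) := fun z => by
    simp [e, MeasurableEquiv.piFinSuccAbove, Fin.insertNthEquiv]
  have hm : MeasurableSet (e.symm ⁻¹' A) := e.symm.measurable hA
  have hvol : volume (e.symm ⁻¹' A) = volume A := he.symm.measure_preimage hA.nullMeasurableSet
  have hsm : Measurable s := by
    have := (measurable_measure_prodMk_left (ν := (volume : Measure (Fin n → ℝ))) hm).ennreal_toReal
    convert this using 3 with x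
    simp [s, Measure.real, Set.preimage, hes]
  obtain ⟨R, hR⟩ := hAb.subset_closedBall 0
  have hsec : ∀ x, {y | (Fin.cons x y : Fin (n + 1) → ℝ) ∈ A} ⊆ Metric.closedBall 0 R :=
    setOf_cons_mem_subset_closedBall hR
  have hfin : ∀ x, volume {y | (Fin.cons x y : Fin (n + 1) → ℝ) ∈ A} ≠ ⊤ := fun x =>
    ((measure_mono (hsec x)).trans_lt measure_closedBall_lt_top).ne
  have hA' : volume A = ∫⁻ x, ENNReal.ofReal (s x) := by
    rw [← hvol, Measure.volume_eq_prod, Measure.prod_apply hm]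
    refine lintegral_congr fun x => ?_
    simp only [s, Measure.real]
    rw [ENNReal.ofReal_toReal (hfin x)]
    simp [Set.preimage, hes]
  have hs0 : ∀ x, 0 ≤ s x := fun x => measureReal_nonneg
  have hAfin : volume A < ⊤ := hAb.measure_lt_top
  refine ⟨hsm, ?_, ?_, ?_⟩
  · refine ⟨hsm.aestronglyMeasurable, ?_⟩
    rw [hasFiniteIntegral_iff_ofReal (Filter.Eventually.of_forall hs0), ← hA']
    exact hAfin
  · refine ⟨(volume : Measure (Fin n → ℝ)).real (Metric.closedBall 0 R), ?_⟩
    rintro _ ⟨x, rfl⟩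
    exact measureReal_mono (hsec x) measure_closedBall_lt_top.ne
  · rw [integral_eq_lintegral_of_nonneg_ae (Filter.Eventually.of_forall hs0)
      hsm.aestronglyMeasurable, ← hA']
    rfl

/-- The multiplicative form of the Brunn–Minkowski inequality. -/
theorem volume_rpow_mul_le {n : ℕ} {A B W : Set (Fin n → ℝ)} (hA : MeasurableSet A)
    (hB : MeasurableSet B) (hW : MeasurableSet W) (hAb : Bornology.IsBounded A)
    (hBb : Bornology.IsBounded B) (hWb : Bornology.IsBounded W) {l : ℝ} (hl0 : 0 < l) (hl1 : l < 1)
    (h : ∀ x ∈ A, ∀ y ∈ B, (1 - l) • x + l • y ∈ W) :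
    volume.real A ^ (1 - l) * volume.real B ^ l ≤ volume.real W := by
  have hl1' : 0 < 1 - l := by linarith
  induction n with
  | zero =>
    rcases A.eq_empty_or_nonempty with rfl | ⟨x, hx⟩
    · simp [Real.zero_rpow hl1'.ne']
    rcases B.eq_empty_or_nonempty with rfl | ⟨y, hy⟩
    · simp [Real.zero_rpow hl0.ne']
    have hu : ∀ S : Set (Fin 0 → ℝ), S.Nonempty → S = Set.univ := fun S hS =>
      Subsingleton.eq_univ_of_nonempty hS
    rw [hu A ⟨x, hx⟩, hu B ⟨y, hy⟩, hu W ⟨_, h x hx y hy⟩]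
    simp [Measure.real, volume_pi]
  | succ n ih =>
    obtain ⟨hfm, hfi, hfb, hfA⟩ := volume_real_eq_integral_cons hA hAb
    obtain ⟨hgm, hgi, hgb, hgB⟩ := volume_real_eq_integral_cons hB hBb
    obtain ⟨hhm, hhi, -, hhW⟩ := volume_real_eq_integral_cons hW hWb
    rw [hfA, hgB, hhW]
    have hcm : ∀ x : ℝ, Measurable fun y : Fin n → ℝ => (Fin.cons x y : Fin (n + 1) → ℝ) := by
      intro x
      refine measurable_pi_iff.2 fun i => ?_
      refine Fin.cases ?_ (fun j => ?_) i
      · simp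
      · simpa using measurable_pi_apply j
    have hcb : ∀ (x : ℝ) (S : Set (Fin (n + 1) → ℝ)), Bornology.IsBounded S →
        Bornology.IsBounded {y : Fin n → ℝ | (Fin.cons x y : Fin (n + 1) → ℝ) ∈ S} := by
      intro x S hS
      obtain ⟨R, hR⟩ := hS.subset_closedBall 0
      exact Metric.isBounded_closedBall.subset (setOf_cons_mem_subset_closedBall hR x)
    refine integral_rpow_mul_le hfm hgm hhm (fun _ => measureReal_nonneg)
      (fun _ => measureReal_nonneg) (fun _ => measureReal_nonneg) hfi hgi hhi hfb hgb hl0 hl1 ?_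
    intro x y
    refine ih (hcm _ hA) (hcm _ hB) (hcm _ hW) (hcb _ _ hAb) (hcb _ _ hBb) (hcb _ _ hWb) ?_
    intro u hu v hv
    have := h _ hu _ hv
    show Fin.cons _ _ ∈ W
    convert this using 1
    ext i
    refine Fin.cases ?_ (fun j => ?_) i <;> simp

/-- A consequence of the Brunn–Minkowski inequality that does not involve roots. -/
theorem le_volume_of_combo_subset {n : ℕ} {A B W : Set (EuclideanSpace ℝ (Fin n))}
    (hA : IsCompact A) (hB : IsCompact B) (hW : IsCompact W) {l : ℝ} (hl0 : 0 ≤ l) (hl1 : l ≤ 1)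
    (h : ∀ x ∈ A, ∀ y ∈ B, (1 - l) • x + l • y ∈ W) {c : ℝ} (hc : 0 < c)
    (hcA : c ≤ volume.real A) (hcB : c ≤ volume.real B) : c ≤ volume.real W := by
  have ne : ∀ S : Set (EuclideanSpace ℝ (Fin n)), c ≤ volume.real S → S.Nonempty := by
    intro S hS
    by_contra h0
    rw [Set.not_nonempty_iff_eq_empty] at h0
    simp [h0] at hS
    linarith
  rcases hl0.eq_or_lt with rfl | hl0
  · obtain ⟨y, hy⟩ := ne B hcB
    exact hcA.trans (measureReal_mono (fun x hx => by simpa using h x hx y hy) hW.measure_lt_top.ne)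
  rcases hl1.eq_or_lt with rfl | hl1
  · obtain ⟨x, hx⟩ := ne A hcA
    exact hcB.trans (measureReal_mono (fun y hy => by simpa using h x hx y hy) hW.measure_lt_top.ne)
  have hmp := PiLp.volume_preserving_toLp (Fin n)
  have hcont : Continuous (WithLp.ofLp : EuclideanSpace ℝ (Fin n) → (Fin n → ℝ)) :=
    PiLp.continuous_ofLp 2 _
  have hpre : ∀ S : Set (EuclideanSpace ℝ (Fin n)), IsCompact S →
      IsCompact ((WithLp.toLp 2 : (Fin n → ℝ) → EuclideanSpace ℝ (Fin n)) ⁻¹' S) := by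
    intro S hS
    convert hS.image hcont using 1
    ext x
    constructor
    · exact fun hx => ⟨_, hx, rfl⟩
    · rintro ⟨y, hy, rfl⟩; exact hy
  have hv : ∀ S : Set (EuclideanSpace ℝ (Fin n)), IsCompact S →
      volume.real ((WithLp.toLp 2 : (Fin n → ℝ) → EuclideanSpace ℝ (Fin n)) ⁻¹' S)
        = volume.real S := by
    intro S hS
    simp only [Measure.real]
    rw [hmp.measure_preimage hS.measurableSet.nullMeasurableSet]
  have main := volume_rpow_mul_le (hpre A hA).measurableSet (hpre B hB).measurableSet
    (hpre W hW).measurableSet (hpre A hA).isBounded (hpre B hB).isBounded (hpre W hW).isBounded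
    hl0 hl1 (fun x hx y hy => by simpa using h _ hx _ hy)
  rw [hv A hA, hv B hB, hv W hW] at main
  refine le_trans ?_ main
  calc c = c ^ (1 - l) * c ^ l := by rw [← Real.rpow_add hc]; simp
    _ ≤ _ := mul_le_mul (Real.rpow_le_rpow hc.le hcA (by linarith))
        (Real.rpow_le_rpow hc.le hcB hl0.le) (by positivity) (by positivity)

/-! ### The Chebyshev system and the sign argument. -/

theorem strictMono_abs_rpow_mul {p : ℝ} (hp : 1 < p) : StrictMono fun t : ℝ => |t| ^ (p - 2) * t := by
  refine strictMono_of_odd_strictMonoOn_nonneg (fun t => by simp) ?_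
  have h : ∀ t : ℝ, 0 ≤ t → |t| ^ (p - 2) * t = t ^ (p - 1) := by
    intro t ht
    rcases ht.eq_or_lt with rfl | ht
    · simp [Real.zero_rpow (by linarith : p - 1 ≠ 0)]
    · rw [abs_of_pos ht, ← Real.rpow_add_one ht.ne']; ring_nf
  intro s hs t ht hst
  simp only [h s hs, h t ht]
  exact Real.rpow_lt_rpow hs hst (by linarith)

theorem strictConvexOn_abs_rpow {r : ℝ} (hr : 1 < r) :
    StrictConvexOn ℝ Set.univ fun t : ℝ => |t| ^ r := by
  have hc : Continuous fun t : ℝ => |t| ^ r :=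
    continuous_abs.rpow_const fun _ => Or.inr (by linarith)
  refine StrictMono.strictConvexOn_univ_of_deriv hc ?_
  have : deriv (fun t : ℝ => |t| ^ r) = fun t => r * (|t| ^ (r - 2) * t) := by
    ext t
    rw [(hasDerivAt_abs_rpow t hr).deriv]; ring
  rw [this]
  exact (strictMono_abs_rpow_mul hr).const_mul (by linarith)

theorem StrictConvexOn.sign_of_two_zeros {g : ℝ → ℝ} (hg : StrictConvexOn ℝ Set.univ g) {a b : ℝ}
    (hab : a < b) (ha : g a = 0) (hb : g b = 0) :
    (∀ x < a, 0 < g x) ∧ (∀ x, a < x → x < b → g x < 0) ∧ ∀ x, b < x → 0 < g x := by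
  refine ⟨fun x hx => ?_, fun x hax hxb => ?_, fun x hx => ?_⟩
  · have := hg.lt_on_openSegment (Set.mem_univ x) (Set.mem_univ b) (hx.trans hab).ne
      (z := a) (by rw [openSegment_eq_Ioo (hx.trans hab)]; exact ⟨hx, hab⟩)
    rw [ha, hb] at this
    simpa using this
  · have := hg.lt_on_openSegment (Set.mem_univ a) (Set.mem_univ b) hab.ne
      (z := x) (by rw [openSegment_eq_Ioo hab]; exact ⟨hax, hxb⟩)
    simpa [ha, hb] using this
  · have := hg.lt_on_openSegment (Set.mem_univ a) (Set.mem_univ x) (hab.trans hx).ne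
      (z := b) (by rw [openSegment_eq_Ioo (hab.trans hx)]; exact ⟨hab, hx⟩)
    rw [ha, hb] at this
    simpa using this

/-- `1`, `|t|^(p-2) t`, `|t|^(q-1)` form a Chebyshev system. -/
theorem exists_interpolant {p q : ℝ} (hp : 1 < p) (hpq : p < q) {t₁ t₂ : ℝ} (h12 : t₁ < t₂) :
    ∃ B C : ℝ, (∀ t < t₁, 0 < |t| ^ (q - 1) - B - C * (|t| ^ (p - 2) * t)) ∧
      (∀ t, t₁ < t → t < t₂ → |t| ^ (q - 1) - B - C * (|t| ^ (p - 2) * t) < 0) ∧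
      ∀ t, t₂ < t → 0 < |t| ^ (q - 1) - B - C * (|t| ^ (p - 2) * t) := by
  -- In the increasing variable `u`, the function `|t|^(q-1)` becomes `|u|^r` with `r > 1`, which is
  -- strictly convex; `B + C u` is its secant through the two nodes.
  set u : ℝ → ℝ := fun t => |t| ^ (p - 2) * t with hu
  have hum : StrictMono u := strictMono_abs_rpow_mul hp
  set r := (q - 1) / (p - 1) with hr
  have hr1 : 1 < r := by rw [hr, one_lt_div (by linarith)]; linarith
  have hur : ∀ t, |u t| ^ r = |t| ^ (q - 1) := by
    intro t
    rcases eq_or_ne t 0 with rfl | ht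
    · simp [hu, Real.zero_rpow (by linarith : r ≠ 0), Real.zero_rpow (by linarith : q - 1 ≠ 0)]
    · have h0 : 0 < |t| := abs_pos.2 ht
      have : |u t| = |t| ^ (p - 1) := by
        rw [hu, abs_mul, abs_of_nonneg (Real.rpow_nonneg h0.le _), ← Real.rpow_add_one h0.ne']
        ring_nf
      rw [this, ← Real.rpow_mul h0.le, hr, mul_div_cancel₀ _ (by linarith)]
  have hlt := hum h12
  set C := (|u t₂| ^ r - |u t₁| ^ r) / (u t₂ - u t₁) with hC
  set B := |u t₁| ^ r - C * u t₁ with hB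
  have hd : u t₂ - u t₁ ≠ 0 := by linarith
  have hCd : C * (u t₂ - u t₁) = |u t₂| ^ r - |u t₁| ^ r := div_mul_cancel₀ _ hd
  have hconv : StrictConvexOn ℝ Set.univ fun x : ℝ => |x| ^ r - B - C * x := by
    have h1 : ConvexOn ℝ Set.univ fun x : ℝ => -B - C * x := by
      refine ⟨convex_univ, fun x _ y _ a b _ _ hab => le_of_eq ?_⟩
      simp only [smul_eq_mul]
      linear_combination B * hab
    have := (strictConvexOn_abs_rpow hr1).add_convexOn h1
    refine this.congr fun x _ => ?_
    simp only [Pi.add_apply]; ring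
  obtain ⟨s1, s2, s3⟩ := hconv.sign_of_two_zeros hlt (by simp only [hB]; ring)
    (by simp only [hB]; linarith)
  refine ⟨B, C, fun t ht => ?_, fun t h1 h2 => ?_, fun t ht => ?_⟩
  · rw [← hur]; exact s1 _ (hum ht)
  · rw [← hur]; exact s2 _ (hum h1) (hum h2)
  · rw [← hur]; exact s3 _ (hum ht)

theorem continuous_abs_rpow_mul {p : ℝ} (hp : 1 < p) : Continuous fun t : ℝ => |t| ^ (p - 2) * t := by
  -- For `p < 2` the first factor is singular at zero; the rewritten form has a positive exponent
  -- and a bounded sign, which gives continuity there.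
  have : (fun t : ℝ => |t| ^ (p - 2) * t) = fun t => |t| ^ (p - 1) * (SignType.sign t : ℝ) := by
    ext t
    rcases eq_or_ne t 0 with rfl | ht
    · simp
    · have h0 : 0 < |t| := abs_pos.2 ht
      rw [show p - 1 = p - 2 + 1 by ring, Real.rpow_add_one h0.ne', mul_assoc, abs_mul_sign]
  rw [continuous_iff_continuousAt]
  intro t
  rcases eq_or_ne t 0 with rfl | ht
  · rw [this]
    have h1 : Filter.Tendsto (fun t : ℝ => |t| ^ (p - 1)) (nhds 0) (nhds 0) := by
      have : Continuous fun t : ℝ => |t| ^ (p - 1) :=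
        continuous_abs.rpow_const fun _ => Or.inr (by linarith)
      simpa [Real.zero_rpow (by linarith : p - 1 ≠ 0)] using this.tendsto 0
    rw [ContinuousAt]
    simp only [sign_zero, SignType.coe_zero, mul_zero]
    refine squeeze_zero_norm (fun t => ?_) h1
    rw [norm_mul, Real.norm_of_nonneg (by positivity)]
    refine mul_le_of_le_one_right (by positivity) ?_
    rcases lt_trichotomy t 0 with h | h | h <;> simp [h]
  · exact ((continuousAt_id.abs).rpow_const (Or.inl (by simpa using ht))).mul continuousAt_id

/-- A function with sign pattern `-, +, -` that is orthogonal to `1` and `|t|^(p-2) t`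
has nonpositive integral against `|t|^(q-1)`, and strictly so unless it vanishes. -/
theorem integral_abs_rpow_mul_le_zero {p q : ℝ} (hp : 1 < p) (hpq : p < q) {D : ℝ → ℝ}
    (hDm : Measurable D) (hD1 : ∀ t, |D t| ≤ 1) {t₁ t₂ : ℝ} (h12 : t₁ < t₂)
    (hl : ∀ᵐ t, t < t₁ → D t ≤ 0) (hm : ∀ t, t₁ < t → t < t₂ → 0 ≤ D t) (hr : ∀ t, t₂ < t → D t ≤ 0)
    {M : ℝ} (h0 : ∫ t in Set.Ioc (-M) M, D t = 0)
    (h1 : ∫ t in Set.Ioc (-M) M, |t| ^ (p - 2) * t * D t = 0) :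
    ∫ t in Set.Ioc (-M) M, |t| ^ (q - 1) * D t ≤ 0 ∧
      (∫ t in Set.Ioc (-M) M, |t| ^ (q - 1) * D t = 0 →
        ∀ᵐ t ∂(volume.restrict (Set.Ioc (-M) M)), D t = 0) := by
  -- The interpolant `h` with nodes `t₁`, `t₂` has signs `+, -, +`, opposite to those of `D`. By the
  -- two orthogonality relations, `h` and `|t|^(q-1)` have the same integral against `D`.
  obtain ⟨B, C, s1, s2, s3⟩ := exists_interpolant hp hpq h12
  have hint : ∀ g : ℝ → ℝ, Continuous g →
      Integrable (fun t => g t * D t) (volume.restrict (Set.Ioc (-M) M)) := by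
    intro g hg
    refine Integrable.mul_bdd (c := 1) ?_ hDm.aestronglyMeasurable
      (Filter.Eventually.of_forall fun t => by simpa using hD1 t)
    exact (hg.continuousOn.integrableOn_compact isCompact_Icc).mono_set Set.Ioc_subset_Icc_self
  have i0 := hint (fun _ => 1) continuous_const
  have i1 := hint _ (continuous_abs_rpow_mul hp)
  have i2 := hint (fun t => |t| ^ (q - 1))
    (continuous_abs.rpow_const fun _ => Or.inr (by linarith))
  simp only [one_mul] at i0
  set h : ℝ → ℝ := fun t => |t| ^ (q - 1) - B - C * (|t| ^ (p - 2) * t) with hh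
  have hDh : (fun t => h t * D t) =
      fun t => |t| ^ (q - 1) * D t - B * D t - C * (|t| ^ (p - 2) * t * D t) := by
    ext t; simp only [hh]; ring
  have i3 : Integrable (fun t => |t| ^ (q - 1) * D t - B * D t)
      (volume.restrict (Set.Ioc (-M) M)) := i2.sub (i0.const_mul B)
  have hi : Integrable (fun t => h t * D t) (volume.restrict (Set.Ioc (-M) M)) := by
    rw [hDh]; exact i3.sub (i1.const_mul C)
  have hI : ∫ t in Set.Ioc (-M) M, |t| ^ (q - 1) * D t = ∫ t in Set.Ioc (-M) M, h t * D t := by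
    rw [hDh, integral_sub i3 (i1.const_mul C),
      integral_sub i2 (i0.const_mul B), integral_const_mul, integral_const_mul, h0, h1]
    ring
  have hne : ∀ᵐ t ∂(volume.restrict (Set.Ioc (-M) M)), t ≠ t₁ ∧ t ≠ t₂ := by
    refine ae_restrict_of_ae ?_
    filter_upwards [Measure.ae_ne volume t₁, Measure.ae_ne volume t₂] with t a b using ⟨a, b⟩
  have hneg : ∀ᵐ t ∂(volume.restrict (Set.Ioc (-M) M)), 0 ≤ -(h t * D t) := by
    filter_upwards [hne, ae_restrict_of_ae hl] with t ht hl
    rw [neg_nonneg]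
    rcases lt_or_gt_of_ne ht.1 with a | a
    · exact mul_nonpos_of_nonneg_of_nonpos (s1 t a).le (hl a)
    rcases lt_or_gt_of_ne ht.2 with b | b
    · exact mul_nonpos_of_nonpos_of_nonneg (s2 t a b).le (hm t a b)
    · exact mul_nonpos_of_nonneg_of_nonpos (s3 t b).le (hr t b)
  rw [hI]
  have hnn := integral_nonneg_of_ae hneg
  rw [integral_neg] at hnn
  refine ⟨by linarith, fun hz => ?_⟩
  have hz' : ∫ t in Set.Ioc (-M) M, -(h t * D t) = 0 := by rw [integral_neg, hz, neg_zero]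
  rw [integral_eq_zero_iff_of_nonneg_ae hneg hi.neg] at hz'
  filter_upwards [hne, hz'] with t ht hzt
  have hzt : h t * D t = 0 := by simpa using hzt
  refine (mul_eq_zero.1 hzt).resolve_left ?_
  rcases lt_or_gt_of_ne ht.1 with a | a
  · exact (s1 t a).ne'
  rcases lt_or_gt_of_ne ht.2 with b | b
  · exact (s2 t a b).ne
  · exact (s3 t b).ne'

/-! ### Moments as integrals of the tail. -/

theorem hasDerivAt_abs_rpow_mul_sign {q : ℝ} (hq : 1 < q) (t : ℝ) :
    HasDerivAt (fun t : ℝ => |t| ^ q * Real.sign t) (q * |t| ^ (q - 1)) t := by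
  have hc : Continuous fun t : ℝ => |t| ^ q * Real.sign t := by
    have : (fun t : ℝ => |t| ^ q * Real.sign t) = fun t => |t| ^ (q + 1 - 2) * t := by
      ext t
      rcases lt_trichotomy t 0 with h | rfl | h
      · have h0 : 0 < |t| := abs_pos.2 h.ne
        rw [Real.sign_of_neg h, show q = q + 1 - 2 + 1 by ring, Real.rpow_add_one h0.ne',
          abs_of_neg h]
        ring_nf
      · simp
      · have h0 : 0 < |t| := abs_pos.2 h.ne'
        rw [Real.sign_of_pos h, show q = q + 1 - 2 + 1 by ring, Real.rpow_add_one h0.ne',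
          abs_of_pos h]
        ring_nf
    rw [this]
    exact continuous_abs_rpow_mul (by linarith)
  have hne : ∀ y : ℝ, y ≠ 0 → HasDerivAt (fun t : ℝ => |t| ^ q * Real.sign t)
      (q * |y| ^ (q - 1)) y := by
    intro y hy
    have h0 : 0 < |y| := abs_pos.2 hy
    have hev : (fun t : ℝ => |t| ^ q * Real.sign t) =ᶠ[nhds y] fun t => |t| ^ q * Real.sign y := by
      rcases lt_or_gt_of_ne hy with h | h
      · filter_upwards [Iio_mem_nhds h] with t ht
        rw [Real.sign_of_neg h, Real.sign_of_neg ht]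
      · filter_upwards [Ioi_mem_nhds h] with t ht
        rw [Real.sign_of_pos h, Real.sign_of_pos ht]
    have hd := ((hasDerivAt_abs_rpow y hq).mul_const (Real.sign y)).congr_of_eventuallyEq hev
    have : y * Real.sign y = |y| := by
      rcases lt_or_gt_of_ne hy with h | h
      · rw [Real.sign_of_neg h, abs_of_neg h]; ring
      · rw [Real.sign_of_pos h, abs_of_pos h]; ring
    rwa [mul_assoc (q * _), this, mul_assoc, ← Real.rpow_add_one h0.ne',
      show q - 2 + 1 = q - 1 by ring] at hd
  -- At zero, where the sign jumps, the derivative is obtained by extending continuously the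
  -- derivative at nearby points.
  rcases eq_or_ne t 0 with rfl | ht
  · refine hasDerivAt_of_hasDerivAt_of_ne hne hc.continuousAt ?_
    exact (continuous_const.mul
      (continuous_abs.rpow_const fun _ => Or.inr (by linarith))).continuousAt
  · exact hne t ht

/-- Layer cake: write `ψ(X)` as `ψ(-M)` plus the integral of `ψ'` over the levels up to `X`, then
apply Fubini. -/
theorem integral_comp_eq_integral_tail {Ω : Type*} [MeasurableSpace Ω] {μ : Measure Ω}
    [IsProbabilityMeasure μ] {X : Ω → ℝ} (hX : Measurable X) {M : ℝ}
    (hM : ∀ᵐ x ∂μ, X x ∈ Set.Icc (-M) M) {ψ ψ' : ℝ → ℝ} (hψ : ∀ t, HasDerivAt ψ (ψ' t) t)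
    (hψ' : Continuous ψ') :
    ∫ x, ψ (X x) ∂μ = ψ (-M) + ∫ t in Set.Ioc (-M) M, ψ' t * μ.real {x | t ≤ X x} := by
  have hpt : ∀ᵐ x ∂μ, ψ (X x) = ψ (-M) +
      ∫ t in Set.Ioc (-M) M, {y | t ≤ X y}.indicator (fun _ => ψ' t) x := by
    filter_upwards [hM] with x hx
    have h1 : ∫ t in (-M)..(X x), ψ' t = ψ (X x) - ψ (-M) :=
      intervalIntegral.integral_eq_sub_of_hasDerivAt (fun t _ => hψ t)
        (hψ'.intervalIntegrable _ _)
    rw [intervalIntegral.integral_of_le hx.1] at h1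
    have h2 : ∫ t in Set.Ioc (-M) M, {y | t ≤ X y}.indicator (fun _ => ψ' t) x =
        ∫ t in Set.Ioc (-M) M, (Set.Iic (X x)).indicator ψ' t := by
      refine integral_congr_ae (Filter.Eventually.of_forall fun t => ?_)
      by_cases h : t ≤ X x <;> simp [Set.indicator, h]
    rw [h2, setIntegral_indicator measurableSet_Iic, Set.Ioc_inter_Iic, min_eq_right hx.2, h1]
    ring
  rw [integral_congr_ae hpt]
  obtain ⟨Q, hQ⟩ := isCompact_Icc.exists_bound_of_continuousOn (s := Set.Icc (-M) M)
    hψ'.continuousOn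
  have hmeas : Measurable (Function.uncurry fun (x : Ω) (t : ℝ) =>
      {y | t ≤ X y}.indicator (fun _ => ψ' t) x) := by
    have : (Function.uncurry fun (x : Ω) (t : ℝ) => {y | t ≤ X y}.indicator (fun _ => ψ' t) x) =
        {z : Ω × ℝ | z.2 ≤ X z.1}.indicator fun z => ψ' z.2 := by
      ext ⟨x, t⟩
      by_cases h : t ≤ X x <;> simp [Set.indicator, h]
    rw [this]
    exact (hψ'.measurable.comp measurable_snd).indicator
      (measurableSet_le measurable_snd (hX.comp measurable_fst))
  have hint : Integrable (Function.uncurry fun (x : Ω) (t : ℝ) =>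
      {y | t ≤ X y}.indicator (fun _ => ψ' t) x) (μ.prod (volume.restrict (Set.Ioc (-M) M))) := by
    refine Integrable.of_bound hmeas.aestronglyMeasurable Q ?_
    have : ∀ᵐ z ∂(μ.prod (volume.restrict (Set.Ioc (-M) M))), z.2 ∈ Set.Ioc (-M) M :=
      Measure.quasiMeasurePreserving_snd.ae (ae_restrict_mem measurableSet_Ioc)
    filter_upwards [this] with z hz
    have hb := hQ z.2 (Set.Ioc_subset_Icc_self hz)
    simp only [Function.uncurry]
    exact (norm_indicator_le_norm_self (s := {y | z.2 ≤ X y}) (fun _ => ψ' z.2) z.1).trans hb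
  have hcongr : ∀ t, ∫ x, {y | t ≤ X y}.indicator (fun _ => ψ' t) x ∂μ =
      ψ' t * μ.real {x | t ≤ X x} := by
    intro t
    rw [integral_indicator (measurableSet_le measurable_const hX)]
    simp [mul_comm]
  have hint' : Integrable (fun x => ∫ t in Set.Ioc (-M) M,
      {y | t ≤ X y}.indicator (fun _ => ψ' t) x) μ := hint.integral_prod_left
  rw [integral_add (integrable_const _) hint', integral_integral_swap hint]
  simp [hcongr]

/-! ### Caps, tails and the comparison with cone tails. -/

noncomputable section

variable {n : ℕ}

/-- The part of `K` on which `⟪x, θ⟫ ≥ t`. -/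
def cap (K : Set (EuclideanSpace ℝ (Fin n))) (θ : EuclideanSpace ℝ (Fin n)) (t : ℝ) :
    Set (EuclideanSpace ℝ (Fin n)) :=
  K ∩ {x | t ≤ inner ℝ x θ}

/-- `P(⟪X, θ⟫ ≥ t)` for `X` uniform on `K`. -/
def tail (K : Set (EuclideanSpace ℝ (Fin n))) (θ : EuclideanSpace ℝ (Fin n)) (t : ℝ) : ℝ :=
  (unif K).real {x | t ≤ inner ℝ x θ}

/-- The tail function of a linear functional on an `n`-dimensional cone
with base at height `a` and apex at height `b`. -/
def coneTail (n : ℕ) (a b t : ℝ) : ℝ :=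
  (max 0 (min 1 ((b - t) / (b - a)))) ^ n

theorem IsConvexBody.volume_ne_zero {K : Set (EuclideanSpace ℝ (Fin n))} (hK : IsConvexBody K) :
    volume K ≠ 0 :=
  (Measure.measure_pos_of_nonempty_interior _ hK.interior_nonempty).ne'

theorem IsConvexBody.volume_real_pos {K : Set (EuclideanSpace ℝ (Fin n))} (hK : IsConvexBody K) :
    0 < volume.real K :=
  ENNReal.toReal_pos hK.volume_ne_zero hK.isCompact.measure_lt_top.ne

theorem IsConvexBody.isProbabilityMeasure_unif {K : Set (EuclideanSpace ℝ (Fin n))}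
    (hK : IsConvexBody K) : IsProbabilityMeasure (unif K) :=
  ProbabilityTheory.cond_isProbabilityMeasure_of_finite hK.volume_ne_zero
    hK.isCompact.measure_lt_top.ne

theorem measurable_inner_right (θ : EuclideanSpace ℝ (Fin n)) :
    Measurable fun x : EuclideanSpace ℝ (Fin n) => inner ℝ x θ :=
  (continuous_id.inner continuous_const).measurable

theorem IsConvexBody.tail_eq {K : Set (EuclideanSpace ℝ (Fin n))} (hK : IsConvexBody K)
    (θ : EuclideanSpace ℝ (Fin n)) (t : ℝ) :
    tail K θ t = volume.real (cap K θ t) / volume.real K := by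
  rw [tail, unif, Measure.real, ProbabilityTheory.cond_apply hK.isCompact.measurableSet,
    ENNReal.toReal_mul, ENNReal.toReal_inv, div_eq_inv_mul]
  rfl

theorem IsConvexBody.isCompact_cap {K : Set (EuclideanSpace ℝ (Fin n))} (hK : IsConvexBody K)
    (θ : EuclideanSpace ℝ (Fin n)) (t : ℝ) : IsCompact (cap K θ t) :=
  hK.isCompact.inter_right (isClosed_le continuous_const (continuous_id.inner continuous_const))

theorem IsConvexBody.convex_cap {K : Set (EuclideanSpace ℝ (Fin n))} (hK : IsConvexBody K)
    (θ : EuclideanSpace ℝ (Fin n)) (t : ℝ) : Convex ℝ (cap K θ t) := by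
  refine hK.convex.inter fun x hx y hy a b ha hb hab => ?_
  simp only [Set.mem_ofPred_eq, inner_add_left, real_inner_smul_left] at *
  calc t = a * t + b * t := by rw [← add_mul, hab, one_mul]
    _ ≤ _ := by gcongr

theorem IsConvexBody.tail_le_one {K : Set (EuclideanSpace ℝ (Fin n))} (hK : IsConvexBody K)
    (θ : EuclideanSpace ℝ (Fin n)) (t : ℝ) : tail K θ t ≤ 1 :=
  have := hK.isProbabilityMeasure_unif
  measureReal_le_one

theorem tail_nonneg (K : Set (EuclideanSpace ℝ (Fin n))) (θ : EuclideanSpace ℝ (Fin n)) (t : ℝ) :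
    0 ≤ tail K θ t :=
  measureReal_nonneg

theorem IsConvexBody.antitone_tail {K : Set (EuclideanSpace ℝ (Fin n))} (hK : IsConvexBody K)
    (θ : EuclideanSpace ℝ (Fin n)) : Antitone (tail K θ) := fun _ _ hst =>
  have := hK.isProbabilityMeasure_unif
  measureReal_mono (fun _ hx => le_trans hst hx)

theorem IsConvexBody.exists_inner_bound {K : Set (EuclideanSpace ℝ (Fin n))} (hK : IsConvexBody K)
    (θ : EuclideanSpace ℝ (Fin n)) : ∃ M, ∀ x ∈ K, |inner ℝ x θ| ≤ M := by
  obtain ⟨M, hM⟩ := hK.isCompact.exists_bound_of_continuousOn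
    (f := fun x => inner ℝ x θ) (continuous_id.inner continuous_const).continuousOn
  exact ⟨M, hM⟩

theorem IsConvexBody.tail_eq_zero {K : Set (EuclideanSpace ℝ (Fin n))} (hK : IsConvexBody K)
    {θ : EuclideanSpace ℝ (Fin n)} {M t : ℝ} (hM : ∀ x ∈ K, |inner ℝ x θ| ≤ M) (ht : M < t) :
    tail K θ t = 0 := by
  have : cap K θ t = ∅ := by
    ext x
    simp only [cap, Set.mem_inter_iff, Set.mem_ofPred_eq, Set.mem_empty_iff_false, iff_false, not_and,
      not_le]
    exact fun hx => ((le_abs_self _).trans (hM x hx)).trans_lt ht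
  simp [hK.tail_eq, this]

theorem coneTail_of_le {a b t : ℝ} (hab : a < b) (ht : t ≤ a) : coneTail n a b t = 1 := by
  have : 1 ≤ (b - t) / (b - a) := by rw [one_le_div (by linarith)]; linarith
  simp [coneTail, this]

theorem coneTail_of_ge (hn : 1 ≤ n) {a b t : ℝ} (hab : a < b) (ht : b ≤ t) :
    coneTail n a b t = 0 := by
  have : (b - t) / (b - a) ≤ 0 := div_nonpos_of_nonpos_of_nonneg (by linarith) (by linarith)
  have h2 : min 1 ((b - t) / (b - a)) ≤ 0 := (min_le_right _ _).trans this
  rw [coneTail, max_eq_left h2, zero_pow (by omega)]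

theorem coneTail_of_mem {a b t : ℝ} (hab : a < b) (hat : a ≤ t) (htb : t ≤ b) :
    coneTail n a b t = ((b - t) / (b - a)) ^ n := by
  have h1 : (b - t) / (b - a) ≤ 1 := by rw [div_le_one (by linarith)]; linarith
  have h2 : 0 ≤ (b - t) / (b - a) := div_nonneg (by linarith) (by linarith)
  rw [coneTail, min_eq_right h1, max_eq_right h2]

theorem continuous_coneTail (n : ℕ) (a b : ℝ) : Continuous (coneTail n a b) := by
  unfold coneTail
  fun_prop

theorem coneTail_nonneg (n : ℕ) (a b t : ℝ) : 0 ≤ coneTail n a b t := by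
  unfold coneTail; positivity

theorem coneTail_le_one (n : ℕ) (a b t : ℝ) : coneTail n a b t ≤ 1 :=
  pow_le_one₀ (le_max_left _ _) (max_le zero_le_one (min_le_left _ _))

theorem volume_real_smul_set (r : ℝ) (hr : 0 ≤ r) (S : Set (EuclideanSpace ℝ (Fin n))) :
    volume.real (r • S) = r ^ n * volume.real S := by
  simp [Measure.real, Measure.addHaar_smul, abs_of_nonneg, pow_nonneg hr n,
    ENNReal.toReal_mul]

theorem volume_real_image_homothety (v : EuclideanSpace ℝ (Fin n)) (r : ℝ) (hr : 0 ≤ r)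
    (S : Set (EuclideanSpace ℝ (Fin n))) :
    volume.real (AffineMap.homothety v r '' S) = r ^ n * volume.real S := by
  simp [Measure.real, Measure.addHaar_image_homothety, abs_of_nonneg, pow_nonneg hr n,
    ENNReal.toReal_mul]

/-- The levels at which the tail of `K` dominates that of a cone form an interval. -/
theorem IsConvexBody.coneTail_le_tail_of_between {K : Set (EuclideanSpace ℝ (Fin n))}
    (hK : IsConvexBody K) (θ : EuclideanSpace ℝ (Fin n)) {a b t₀ t t₁ : ℝ} (ha : a ≤ t₀)
    (hb : t₁ < b) (h0 : t₀ ≤ t) (h1 : t ≤ t₁) (hc0 : coneTail n a b t₀ ≤ tail K θ t₀)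
    (hc1 : coneTail n a b t₁ ≤ tail K θ t₁) : coneTail n a b t ≤ tail K θ t := by
  rcases h0.eq_or_lt with rfl | h0
  · exact hc0
  have hab : a < b := by linarith
  have hV := hK.volume_real_pos
  -- Scaling the cap at level `s` by `1/(b - s)` turns the cone's side of the comparison into a
  -- constant. Domination becomes a fixed lower bound on volume, which the root-free Brunn–Minkowski
  -- inequality propagates.
  have conv : ∀ s, a ≤ s → s < b → (coneTail n a b s ≤ tail K θ s ↔
      volume.real K / (b - a) ^ n ≤ volume.real ((b - s)⁻¹ • cap K θ s)) := by
    intro s has hsb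
    have hs : 0 < b - s := by linarith
    have hba : 0 < b - a := by linarith
    rw [coneTail_of_mem hab has hsb.le, hK.tail_eq, volume_real_smul_set _ (inv_nonneg.2 hs.le),
      div_pow, inv_pow, le_div_iff₀ hV, div_mul_eq_mul_div, div_le_iff₀ (by positivity),
      div_le_iff₀ (by positivity), inv_mul_eq_div, div_mul_eq_mul_div, le_div_iff₀ (by positivity),
      mul_comm (volume.real K)]
  rw [conv t₀ ha (by linarith)] at hc0
  rw [conv t₁ (by linarith) hb] at hc1
  rw [conv t (by linarith) (by linarith)]
  have hx0 : 0 < b - t₀ := by linarith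
  have hx1 : 0 < b - t₁ := by linarith
  have hx : 0 < b - t := by linarith
  have hd : 0 < t₁ - t₀ := by linarith
  set m := (t - t₀) / (t₁ - t₀) with hm
  have hmd : m * (t₁ - t₀) = t - t₀ := div_mul_cancel₀ _ hd.ne'
  have hm0 : 0 ≤ m := div_nonneg (by linarith) hd.le
  have hm1 : m ≤ 1 := (div_le_one hd).2 (by linarith)
  -- Projective change of weight: the combination with weight `l` of the rescaled points is the
  -- rescaled combination with weight `m` of the original points.
  set l := m * (b - t₁) / (b - t) with hl
  have hlx : l * (b - t) = m * (b - t₁) := div_mul_cancel₀ _ hx.ne'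
  have hl0 : 0 ≤ l := by positivity
  have hl1 : l ≤ 1 := by
    rw [hl, div_le_one hx]; nlinarith
  refine le_volume_of_combo_subset ((hK.isCompact_cap θ t₀).smul _)
    ((hK.isCompact_cap θ t₁).smul _) ((hK.isCompact_cap θ t).smul _) hl0 hl1 ?_
    (div_pos hV (pow_pos (by linarith) n)) hc0 hc1
  rintro _ ⟨x, hxm, rfl⟩ _ ⟨y, hym, rfl⟩
  refine ⟨(1 - m) • x + m • y, ⟨hK.convex hxm.1 hym.1 (by linarith) hm0 (by ring), ?_⟩, ?_⟩
  · have e0 := hxm.2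
    have e1 := hym.2
    simp only [Set.mem_ofPred_eq, inner_add_left, real_inner_smul_left] at *
    nlinarith [mul_le_mul_of_nonneg_left e0 (by linarith : 0 ≤ 1 - m),
      mul_le_mul_of_nonneg_left e1 hm0]
  · simp only [smul_add, smul_smul]
    congr 2
    · field_simp
      nlinarith
    · field_simp
      linarith

/-- The difference of the tail of `K` and that of a cone has sign pattern `-, +, -`. -/
theorem IsConvexBody.exists_sign_pattern (hn : 1 ≤ n) {K : Set (EuclideanSpace ℝ (Fin n))}
    (hK : IsConvexBody K) (θ : EuclideanSpace ℝ (Fin n)) {a b : ℝ} (hab : a < b) :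
    ∃ t₁ t₂ : ℝ, t₁ < t₂ ∧ (∀ᵐ t, t < t₁ → tail K θ t - coneTail n a b t ≤ 0) ∧
      (∀ t, t₁ < t → t < t₂ → 0 ≤ tail K θ t - coneTail n a b t) ∧
      ∀ t, t₂ < t → tail K θ t - coneTail n a b t ≤ 0 := by
  set S : Set ℝ := {t | a ≤ t ∧ t < b ∧ coneTail n a b t ≤ tail K θ t} with hS
  have hbelow : ∀ t < b, t ∉ S → tail K θ t - coneTail n a b t ≤ 0 := by
    intro t ht htS
    rcases le_or_gt a t with h | h
    · have : ¬ coneTail n a b t ≤ tail K θ t := fun h' => htS ⟨h, ht, h'⟩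
      linarith
    · rw [coneTail_of_le hab h.le]
      linarith [hK.tail_le_one θ t]
  have habove : ∀ t, b ≤ t → coneTail n a b t = 0 := fun t ht => coneTail_of_ge hn hab ht
  have hconn : ∀ s ∈ S, ∀ s' ∈ S, ∀ t, s ≤ t → t ≤ s' → t ∈ S := fun s hs s' hs' t h h' =>
    ⟨hs.1.trans h, h'.trans_lt hs'.2.1,
      hK.coneTail_le_tail_of_between θ hs.1 hs'.2.1 h h' hs.2.2 hs'.2.2⟩
  have hbb : BddBelow S := ⟨a, fun s hs => hs.1⟩
  have hba : BddAbove S := ⟨b, fun s hs => hs.2.1.le⟩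
  have hlow : ∀ t < sInf S, t < b → tail K θ t - coneTail n a b t ≤ 0 := fun t ht htb =>
    hbelow t htb fun h => not_lt.2 (csInf_le hbb h) ht
  rcases (tail_nonneg K θ b).eq_or_lt with hz | hpos
  · have htop : ∀ t, b ≤ t → tail K θ t - coneTail n a b t = 0 := fun t ht => by
      rw [habove t ht, le_antisymm (hz ▸ hK.antitone_tail θ ht) (tail_nonneg K θ t), sub_zero]
    rcases S.subsingleton_or_nontrivial with hs | hs
    -- No genuine positive part: the difference vanishes from `b` on, so any interval starting there
    -- serves as the middle one. The possible single point of `S` is why the left condition holds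
    -- only almost everywhere.
    · refine ⟨b, b + 1, by linarith, ?_, fun t h _ => (htop t h.le).ge,
        fun t ht => (htop t (by linarith)).le⟩
      have : ∀ᵐ t : ℝ, t ∉ S := by
        rw [ae_iff]; simpa using hs.measure_zero volume
      filter_upwards [this] with t ht htb using hbelow t htb ht
    · obtain ⟨x, hx, y, hy, hxy⟩ := hs.exists_lt
      refine ⟨sInf S, sSup S, (csInf_le hbb hx).trans_lt (hxy.trans_le (le_csSup hba hy)), ?_, ?_, ?_⟩
      · refine Filter.Eventually.of_forall fun t ht => hlow t ht ?_
        exact ht.trans ((csInf_le hbb hx).trans_lt hx.2.1)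
      · intro t h1 h2
        obtain ⟨s, hs1, hs2⟩ := exists_lt_of_csInf_lt ⟨x, hx⟩ h1
        obtain ⟨s', hs1', hs2'⟩ := exists_lt_of_lt_csSup ⟨x, hx⟩ h2
        exact sub_nonneg.2 (hconn s hs1 s' hs1' t hs2.le hs2'.le).2.2
      · intro t ht
        rcases lt_or_ge t b with h | h
        · exact hbelow t h fun h => not_lt.2 (le_csSup hba h) ht
        · exact (htop t h).le
  -- If `K` has mass at or above level `b`, the cone tail, tending to zero at `b`, falls below that
  -- of `K` just before `b`. The positive part then continues past `b` to the end of `K`.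
  · have hreach : ∀ t < b, ∃ s ∈ S, t < s := by
      intro t ht
      have hc : ∀ᶠ s in nhdsWithin b (Set.Iio b), coneTail n a b s < tail K θ b := by
        refine ((continuous_coneTail n a b).continuousAt.eventually_lt continuousAt_const ?_).filter_mono
          nhdsWithin_le_nhds
        rwa [habove b le_rfl]
      obtain ⟨s, hs1, hs2⟩ := (hc.and (Ioo_mem_nhdsLT (max_lt ht hab))).exists
      have hsb : s < b := hs2.2
      refine ⟨s, ⟨((le_max_right _ _).trans_lt hs2.1).le, hsb, ?_⟩, (le_max_left _ _).trans_lt hs2.1⟩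
      exact hs1.le.trans (hK.antitone_tail θ hsb.le)
    obtain ⟨x, hx, -⟩ := hreach a hab
    obtain ⟨M, hM⟩ := hK.exists_inner_bound θ
    have h1b : sInf S < b := (csInf_le hbb hx).trans_lt hx.2.1
    refine ⟨sInf S, max M b, h1b.trans_le (le_max_right _ _),
      Filter.Eventually.of_forall fun t ht => hlow t ht (ht.trans h1b), ?_, ?_⟩
    · intro t h1 _
      rcases lt_or_ge t b with h | h
      · obtain ⟨s, hs1, hs2⟩ := exists_lt_of_csInf_lt ⟨x, hx⟩ h1
        obtain ⟨s', hs1', hs2'⟩ := hreach t h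
        exact sub_nonneg.2 (hconn s hs1 s' hs1' t hs2.le hs2'.le).2.2
      · rw [habove t h, sub_zero]; exact tail_nonneg K θ t
    · intro t ht
      rw [hK.tail_eq_zero hM ((le_max_left _ _).trans_lt ht)]
      linarith [coneTail_nonneg n a b t]

end

/-! ### Cones are characterized by their tails. -/

section

variable {n : ℕ}

theorem IsConvexBody.closure_interior {K : Set (EuclideanSpace ℝ (Fin n))} (hK : IsConvexBody K) :
    closure (interior K) = K := by
  rw [hK.convex.closure_interior_eq_closure_of_nonempty_interior hK.interior_nonempty,
    hK.isCompact.isClosed.closure_eq]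

theorem IsConvexBody.volume_real_inter_pos {K U : Set (EuclideanSpace ℝ (Fin n))}
    (hK : IsConvexBody K) (hU : IsOpen U) (h : (K ∩ U).Nonempty) : 0 < volume.real (K ∩ U) := by
  obtain ⟨x, hx, hxU⟩ := h
  rw [← hK.closure_interior] at hx
  obtain ⟨y, hyU, hyK⟩ := mem_closure_iff.1 hx U hU hxU
  have h1 : 0 < volume (interior K ∩ U) :=
    (isOpen_interior.inter hU).measure_pos _ ⟨y, hyK, hyU⟩
  refine ENNReal.toReal_pos (h1.trans_le (measure_mono ?_)).ne'
    ((measure_mono Set.inter_subset_left).trans_lt hK.isCompact.measure_lt_top).ne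
  exact Set.inter_subset_inter_left _ interior_subset

/-- A missing point would have a neighbourhood avoiding the closed set `L`, and this neighbourhood
meets `K` in positive volume. -/
theorem IsConvexBody.subset_of_volume_le {K L : Set (EuclideanSpace ℝ (Fin n))}
    (hK : IsConvexBody K) (hL : IsCompact L) (hLK : L ⊆ K) (h : volume.real K ≤ volume.real L) :
    K ⊆ L := by
  by_contra hc
  rw [Set.not_subset] at hc
  obtain ⟨x, hxK, hxL⟩ := hc
  have h1 := hK.volume_real_inter_pos hL.isClosed.isOpen_compl ⟨x, hxK, hxL⟩
  rw [← Set.sdiff_eq, measureReal_sdiff hLK hL.measurableSet hK.isCompact.measure_lt_top.ne] at h1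
  linarith

theorem image_homothety_subset_cap {K : Set (EuclideanSpace ℝ (Fin n))} (hK : Convex ℝ K)
    {v θ : EuclideanSpace ℝ (Fin n)} (hv : v ∈ K) {a t l : ℝ}
    (ha : ∀ x ∈ K, a ≤ inner ℝ x θ) (hl0 : 0 ≤ l) (hl1 : l ≤ 1)
    (ht : t = inner ℝ v θ - l * (inner ℝ v θ - a)) :
    AffineMap.homothety v l '' K ⊆ cap K θ t := by
  rintro _ ⟨x, hx, rfl⟩
  have e : AffineMap.homothety v l x = (1 - l) • v + l • x := by
    simp only [AffineMap.homothety_apply, vsub_eq_sub, vadd_eq_add]; module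
  rw [e]
  refine ⟨hK hv hx (by linarith) hl0 (by ring), ?_⟩
  simp only [Set.mem_ofPred_eq, inner_add_left, real_inner_smul_left]
  nlinarith [mul_le_mul_of_nonneg_left (ha x hx) hl0]

/-- Every point of the cone is `v + m (y - v)` with `y` in the hull of `B`; its height depends only
on `m`, and it lies in the cap only if `m ≤ l`. -/
theorem cap_convexHull_insert {B : Set (EuclideanSpace ℝ (Fin n))} (hB : B.Nonempty)
    {v θ : EuclideanSpace ℝ (Fin n)} {a l : ℝ} (hBa : ∀ x ∈ B, inner ℝ x θ = a)
    (hav : a < inner ℝ v θ) (hl0 : 0 ≤ l) (hl1 : l ≤ 1) :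
    cap (convexHull ℝ (insert v B)) θ (inner ℝ v θ - l * (inner ℝ v θ - a)) =
      AffineMap.homothety v l '' convexHull ℝ (insert v B) := by
  set K := convexHull ℝ (insert v B) with hK
  have hKc : Convex ℝ K := convex_convexHull _ _
  have hvK : v ∈ K := subset_convexHull _ _ (Set.mem_insert _ _)
  have hBa' : ∀ y ∈ convexHull ℝ B, inner ℝ y θ = a := by
    intro y hy
    have hlin : IsLinearMap ℝ fun y : EuclideanSpace ℝ (Fin n) => inner ℝ y θ :=
      ⟨fun x y => inner_add_left _ _ _, fun c x => real_inner_smul_left _ _ _⟩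
    exact convexHull_min (t := {y | inner ℝ y θ = a}) hBa (convex_hyperplane hlin a) hy
  have hrep : ∀ x ∈ K, ∃ y ∈ convexHull ℝ B, ∃ m : ℝ, 0 ≤ m ∧ m ≤ 1 ∧ x = v + m • (y - v) := by
    intro x hx
    rw [hK, convexHull_insert hB, mem_convexJoin] at hx
    obtain ⟨v', hv', y, hy, hx⟩ := hx
    rw [Set.mem_singleton_iff] at hv'
    subst hv'
    rw [segment_eq_image'] at hx
    obtain ⟨m, hm, rfl⟩ := hx
    exact ⟨y, hy, m, hm.1, hm.2, rfl⟩
  have hBK : convexHull ℝ B ⊆ K := convexHull_mono (Set.subset_insert _ _)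
  have hge : ∀ x ∈ K, a ≤ inner ℝ x θ := by
    intro x hx
    obtain ⟨y, hy, m, hm0, hm1, rfl⟩ := hrep x hx
    rw [inner_add_left, real_inner_smul_left, inner_sub_left, hBa' y hy]
    nlinarith
  refine Set.Subset.antisymm ?_ (image_homothety_subset_cap hKc hvK hge hl0 hl1 rfl)
  rintro x ⟨hx, hxt⟩
  obtain ⟨y, hy, m, hm0, hm1, rfl⟩ := hrep x hx
  simp only [Set.mem_ofPred_eq] at hxt
  rw [inner_add_left, real_inner_smul_left, inner_sub_left, hBa' y hy] at hxt
  have hml : m ≤ l := by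
    by_contra hlt
    push Not at hlt
    nlinarith
  rcases hl0.eq_or_lt with rfl | hl0
  · have : m = 0 := le_antisymm hml hm0
    exact ⟨v, hvK, by simp [this]⟩
  · refine ⟨v + (m / l) • (y - v), ?_, ?_⟩
    · have := hKc.add_smul_sub_mem hvK (hBK hy)
        (t := m / l) ⟨div_nonneg hm0 hl0.le, (div_le_one hl0).2 hml⟩
      exact this
    · simp only [AffineMap.homothety_apply, vsub_eq_sub, vadd_eq_add, add_sub_cancel_left, smul_smul]
      rw [mul_div_cancel₀ _ hl0.ne', add_comm]

theorem IsConeWithBase.exists_tail_eq (hn : 1 ≤ n) {K B : Set (EuclideanSpace ℝ (Fin n))}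
    (hK : IsConvexBody K) (hB : IsConeWithBase K B) :
    ∃ θ : EuclideanSpace ℝ (Fin n), θ ≠ 0 ∧ ∃ a b : ℝ, a < b ∧
      ∀ t, tail K θ t = coneTail n a b t := by
  obtain ⟨H, v, ⟨h, hh⟩, -, hBH, hv, hKe⟩ := hB
  have : NeZero n := ⟨by omega⟩
  have hB0 : B.Nonempty := by
    by_contra h0
    rw [Set.not_nonempty_iff_eq_empty] at h0
    -- With an empty base the hull is the single point `v`, which is null in positive dimension.
    have := hK.volume_ne_zero
    rw [hKe, h0] at this
    simp at this
  set w := v - h with hw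
  -- The component of `v - h` orthogonal to the hyperplane: it is constant on the base and strictly
  -- larger at the apex.
  set θ := w - H.direction.starProjection w with hθ
  have hwd : w ∉ H.direction := by
    rw [hw, ← vsub_eq_sub, AffineSubspace.vsub_right_mem_direction_iff_mem hh]
    exact hv
  have hθ0 : θ ≠ 0 := by
    intro h0
    rw [hθ, sub_eq_zero] at h0
    exact hwd (h0 ▸ Submodule.starProjection_apply_mem _ _)
  have hθd : θ ∈ H.directionᗮ := Submodule.sub_starProjection_mem_orthogonal _
  have horth : ∀ d ∈ H.direction, inner ℝ d θ = 0 := fun d hd => hθd d hd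
  have hwθ : 0 < inner ℝ w θ := by
    have e : w = θ + H.direction.starProjection w := by rw [hθ]; abel
    have h1 : inner ℝ w θ = inner ℝ θ θ := by
      nth_rewrite 1 [e]
      rw [inner_add_left, horth _ (Submodule.starProjection_apply_mem _ _), add_zero]
    rw [h1]
    exact real_inner_self_pos.2 hθ0
  have hBa : ∀ x ∈ B, inner ℝ x θ = inner ℝ h θ := by
    intro x hx
    have := horth _ (AffineSubspace.vsub_mem_direction (hBH hx) hh)
    rw [vsub_eq_sub, inner_sub_left] at this
    linarith
  have hab : (inner ℝ h θ : ℝ) < inner ℝ v θ := by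
    rw [hw, inner_sub_left] at hwθ; linarith
  have hV := hK.volume_real_pos
  refine ⟨θ, hθ0, inner ℝ h θ, inner ℝ v θ, hab, ?_⟩
  have hmid : ∀ t, inner ℝ h θ ≤ t → t ≤ inner ℝ v θ →
      tail K θ t = coneTail n (inner ℝ h θ) (inner ℝ v θ) t := by
    intro t h1 h2
    have hd : 0 < (inner ℝ v θ : ℝ) - inner ℝ h θ := by linarith
    set l := ((inner ℝ v θ : ℝ) - t) / (inner ℝ v θ - inner ℝ h θ) with hl
    have hl0 : 0 ≤ l := div_nonneg (by linarith) hd.le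
    have hl1 : l ≤ 1 := (div_le_one hd).2 (by linarith)
    have hlt : t = inner ℝ v θ - l * (inner ℝ v θ - inner ℝ h θ) := by
      rw [hl, div_mul_cancel₀ _ hd.ne']; ring
    have hcap := cap_convexHull_insert hB0 hBa hab hl0 hl1
    rw [← hKe, ← hlt] at hcap
    rw [coneTail_of_mem hab h1 h2, hK.tail_eq, hcap, volume_real_image_homothety _ _ hl0,
      mul_div_cancel_right₀ _ hV.ne']
  intro t
  rcases le_total t (inner ℝ h θ) with h1 | h1
  · have := hmid _ le_rfl hab.le
    rw [coneTail_of_le hab le_rfl] at this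
    rw [coneTail_of_le hab h1]
    exact le_antisymm (hK.tail_le_one _ _) (this ▸ hK.antitone_tail θ h1)
  rcases le_total t (inner ℝ v θ) with h2 | h2
  · exact hmid t h1 h2
  · have := hmid _ hab.le le_rfl
    rw [coneTail_of_ge hn hab le_rfl] at this
    rw [coneTail_of_ge hn hab h2]
    exact le_antisymm (this ▸ hK.antitone_tail θ h2) (tail_nonneg _ _ _)

/-- Equal volumes force each cap to coincide with the homothetic copy of `K` about a highest point
`v`. Pulling a point back by the homothety adapted to its height lands on the face at height `a`,
which is the base. -/
theorem IsConvexBody.exists_isConeWithBase_of_tail_eq (hn : 1 ≤ n)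
    {K : Set (EuclideanSpace ℝ (Fin n))} (hK : IsConvexBody K) {θ : EuclideanSpace ℝ (Fin n)}
    (hθ : θ ≠ 0) {a b : ℝ} (hab : a < b) (h : ∀ t, tail K θ t = coneTail n a b t) :
    ∃ B, IsConeWithBase K B ∧ IsNormalTo θ B := by
  have hV := hK.volume_real_pos
  have hcont : Continuous fun x : EuclideanSpace ℝ (Fin n) => (inner ℝ x θ : ℝ) :=
    continuous_id.inner continuous_const
  have hvol : ∀ t, volume.real (cap K θ t) = coneTail n a b t * volume.real K := fun t => by
    rw [← h, hK.tail_eq, div_mul_cancel₀ _ hV.ne']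
  have hge : ∀ x ∈ K, a ≤ inner ℝ x θ := fun x hx =>
    (hK.subset_of_volume_le (hK.isCompact_cap θ a) Set.inter_subset_left
      (by rw [hvol, coneTail_of_le hab le_rfl, one_mul]) hx).2
  have hle : ∀ x ∈ K, inner ℝ x θ ≤ b := by
    intro x hx
    by_contra hc
    push Not at hc
    have h1 := hK.volume_real_inter_pos (isOpen_lt continuous_const hcont) ⟨x, hx, hc⟩
    have h2 : volume.real (K ∩ {x | b < inner ℝ x θ}) ≤ volume.real (cap K θ b) :=
      measureReal_mono (fun y hy => ⟨hy.1, hy.2.out.le⟩) (hK.isCompact_cap θ b).measure_lt_top.ne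
    rw [hvol, coneTail_of_ge hn hab le_rfl, zero_mul] at h2
    linarith
  obtain ⟨v, hv, hvmax⟩ := hK.isCompact.exists_isMaxOn
    (hK.interior_nonempty.mono interior_subset) hcont.continuousOn
  have hvb : inner ℝ v θ = b := by
    refine le_antisymm (hle v hv) (le_of_forall_lt fun t ht => ?_)
    -- A level strictly between `t` and `b`, kept at or above `a` so that the polynomial formula for
    -- the tail applies.
    have hpos : 0 < volume.real (cap K θ (max ((t + b) / 2) a)) := by
      have h1 : max ((t + b) / 2) a < b := max_lt (by linarith) hab
      rw [hvol, coneTail_of_mem hab (le_max_right _ _) h1.le]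
      have : 0 < (b - max ((t + b) / 2) a) / (b - a) := div_pos (by linarith) (by linarith)
      positivity
    obtain ⟨x, hx, hxt⟩ : (cap K θ (max ((t + b) / 2) a)).Nonempty := by
      by_contra h0
      rw [Set.not_nonempty_iff_eq_empty] at h0
      simp [h0] at hpos
    have h2 : (inner ℝ x θ : ℝ) ≤ inner ℝ v θ := hvmax hx
    have h3 := (le_max_left _ _).trans hxt.out
    linarith
  have hrep : ∀ l : ℝ, 0 < l → l ≤ 1 → ∀ x ∈ K, b - l * (b - a) ≤ inner ℝ x θ →
      ∃ y ∈ K, x = v + l • (y - v) := by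
    intro l hl0 hl1 x hx hxl
    have hsub : AffineMap.homothety v l '' K ⊆ cap K θ (b - l * (b - a)) :=
      image_homothety_subset_cap hK.convex hv hge hl0.le hl1 (by rw [hvb])
    have hLc : IsCompact (AffineMap.homothety v l '' K) :=
      hK.isCompact.image (AffineMap.homothety_continuous v l)
    have hbody : IsConvexBody (cap K θ (b - l * (b - a))) := by
      refine ⟨hK.convex_cap _ _, hK.isCompact_cap _ _, ?_⟩
      obtain ⟨z, hz⟩ := hK.interior_nonempty
      exact ⟨_, interior_mono hsub ((AffineMap.homothety_isOpenMap v l hl0.ne').image_interior_subset K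
        ⟨z, hz, rfl⟩)⟩
    have hmem : x ∈ AffineMap.homothety v l '' K := by
      refine hbody.subset_of_volume_le hLc hsub ?_ ⟨hx, hxl⟩
      rw [hvol, volume_real_image_homothety _ _ hl0.le,
        coneTail_of_mem hab (by nlinarith) (by nlinarith)]
      have : (b - (b - l * (b - a))) / (b - a) = l := by
        field_simp [(by linarith : b - a ≠ 0)]; ring
      rw [this]
    obtain ⟨y, hy, rfl⟩ := hmem
    refine ⟨y, hy, ?_⟩
    simp only [AffineMap.homothety_apply, vsub_eq_sub, vadd_eq_add, add_comm]
  have hapex : ∀ x ∈ K, inner ℝ x θ = b → x = v := by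
    intro x hx hxb
    obtain ⟨C, hC⟩ := hK.isCompact.isBounded.exists_norm_le
    -- A second point at height `b` lies in every homothetic copy; letting the ratio tend to zero
    -- collapses it onto `v`.
    have hC' : ∀ l : ℝ, 0 < l → l ≤ 1 → ‖x - v‖ ≤ l * (C + C) := by
      intro l hl0 hl1
      obtain ⟨y, hy, hxy⟩ := hrep l hl0 hl1 x hx (by rw [hxb]; nlinarith)
      rw [hxy, add_sub_cancel_left, norm_smul, Real.norm_of_nonneg hl0.le]
      gcongr
      exact (norm_sub_le _ _).trans (add_le_add (hC y hy) (hC v hv))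
    have hlim : Filter.Tendsto (fun l : ℝ => l * (C + C)) (nhdsWithin 0 (Set.Ioi 0)) (nhds 0) := by
      have : Continuous fun l : ℝ => l * (C + C) := by fun_prop
      simpa using (this.tendsto 0).mono_left nhdsWithin_le_nhds
    have h0 : ‖x - v‖ ≤ 0 := by
      refine ge_of_tendsto hlim ?_
      filter_upwards [Ioc_mem_nhdsGT (zero_lt_one' ℝ)] with l hl using hC' l hl.1 hl.2
    exact sub_eq_zero.1 (norm_le_zero_iff.1 h0)
  have hθθ : (inner ℝ θ θ : ℝ) ≠ 0 := inner_self_ne_zero.2 hθ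
  set p₀ : EuclideanSpace ℝ (Fin n) := (a / inner ℝ θ θ) • θ with hp₀
  have hp₀a : inner ℝ p₀ θ = a := by rw [hp₀, real_inner_smul_left, div_mul_cancel₀ _ hθθ]
  have hmemH : ∀ x, x ∈ AffineSubspace.mk' p₀ (Submodule.span ℝ {θ})ᗮ ↔ inner ℝ x θ = a := by
    intro x
    rw [AffineSubspace.mem_mk', Submodule.mem_orthogonal_singleton_iff_inner_left, vsub_eq_sub,
      inner_sub_left, hp₀a, sub_eq_zero]
  refine ⟨K ∩ {x | inner ℝ x θ = a}, ⟨AffineSubspace.mk' p₀ (Submodule.span ℝ {θ})ᗮ, v,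
    ⟨p₀, AffineSubspace.self_mem_mk' _ _⟩, ?_, ?_, ?_, ?_⟩, ?_⟩
  · rw [AffineSubspace.direction_mk']
    obtain ⟨m, rfl⟩ : ∃ m, n = m + 1 := ⟨n - 1, by omega⟩
    have : Fact (Module.finrank ℝ (EuclideanSpace ℝ (Fin (m + 1))) = m + 1) := ⟨by simp⟩
    rw [Submodule.finrank_orthogonal_span_singleton (n := m) hθ]
  · exact fun x hx => (hmemH x).2 hx.2
  · rw [hmemH, hvb]; exact hab.ne'
  · refine Set.Subset.antisymm ?_
      (convexHull_min (Set.insert_subset hv Set.inter_subset_left) hK.convex)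
    intro x hx
    have hvh : v ∈ convexHull ℝ (insert v (K ∩ {x | inner ℝ x θ = a})) :=
      subset_convexHull _ _ (Set.mem_insert _ _)
    rcases (hle x hx).eq_or_lt with hxb | hxb
    · rw [hapex x hx hxb]; exact hvh
    have hba : 0 < b - a := by linarith
    set l := (b - inner ℝ x θ) / (b - a) with hl
    have hl0 : 0 < l := div_pos (by linarith) hba
    have hl1 : l ≤ 1 := (div_le_one hba).2 (by linarith [hge x hx])
    have hlx : l * (b - a) = b - inner ℝ x θ := div_mul_cancel₀ _ hba.ne'
    obtain ⟨y, hy, hxy⟩ := hrep l hl0 hl1 x hx (by linarith)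
    have hya : inner ℝ y θ = a := by
      have e : (inner ℝ x θ : ℝ) = b + l * (inner ℝ y θ - b) := by
        rw [hxy, inner_add_left, real_inner_smul_left, inner_sub_left, hvb]
      have : l * (inner ℝ y θ - a) = 0 := by linarith
      linarith [(mul_eq_zero.1 this).resolve_left hl0.ne']
    rw [hxy]
    exact (convex_convexHull ℝ _).add_smul_sub_mem hvh
      (subset_convexHull _ _ (Set.mem_insert_of_mem _ ⟨hy, hya⟩)) ⟨hl0.le, hl1⟩
  · have hle : vectorSpan ℝ (K ∩ {x | inner ℝ x θ = a}) ≤ (Submodule.span ℝ {θ})ᗮ := by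
      rw [vectorSpan_def, Submodule.span_le]
      rintro _ ⟨x, hx, y, hy, rfl⟩
      simp only [SetLike.mem_coe]
      rw [Submodule.mem_orthogonal_singleton_iff_inner_left, vsub_eq_sub, inner_sub_left,
        hx.2.out, hy.2.out, sub_self]
    exact Submodule.orthogonal_le hle
      (Submodule.le_orthogonal_orthogonal _ (Submodule.mem_span_singleton_self θ))

theorem IsSimplex.isConvexBody {D : Set (EuclideanSpace ℝ (Fin n))} (hD : IsSimplex D) :
    IsConvexBody D := by
  obtain ⟨S, rfl⟩ := hD
  refine ⟨convex_convexHull _ _, (Set.finite_range _).isCompact_convexHull ℝ, ?_⟩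
  rw [interior_convexHull_nonempty_iff_affineSpan_eq_top,
    S.independent.affineSpan_eq_top_iff_card_eq_finrank_add_one]
  simp

theorem IsSimplex.isCone (hn : 1 ≤ n) {D : Set (EuclideanSpace ℝ (Fin n))} (hD : IsSimplex D) :
    IsCone D := by
  obtain ⟨S, rfl⟩ := hD
  obtain ⟨m, rfl⟩ : ∃ m, n = m + 1 := ⟨n - 1, by omega⟩
  refine ⟨Set.range (fun i : Fin (m + 1) => S.points i.succ),
    affineSpan ℝ (Set.range (fun i : Fin (m + 1) => S.points i.succ)), S.points 0,
    ?_, ?_, subset_affineSpan _ _, ?_, ?_⟩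
  · exact (affineSpan_nonempty _).2 (Set.range_nonempty _)
  · rw [direction_affineSpan, AffineIndependent.finrank_vectorSpan (n := m) ?_ (by simp)]
    exact S.independent.comp_embedding (Fin.succEmb _)
  · have := S.independent.notMem_affineSpan_sdiff 0 Set.univ
    convert this using 3
    ext x
    constructor
    · rintro ⟨i, rfl⟩
      exact ⟨i.succ, ⟨trivial, Fin.succ_ne_zero i⟩, rfl⟩
    · rintro ⟨i, ⟨-, hi⟩, rfl⟩
      obtain ⟨j, rfl⟩ := Fin.exists_succ_eq.2 hi
      exact ⟨j, rfl⟩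
  · congr 1
    ext x
    constructor
    · rintro ⟨i, rfl⟩
      refine Fin.cases (Or.inl rfl) (fun j => Or.inr ⟨j, rfl⟩) i
    · rintro (rfl | ⟨i, rfl⟩)
      · exact ⟨0, rfl⟩
      · exact ⟨i.succ, rfl⟩

end

/-! ### Comparison of moments and the extremal direction. -/

noncomputable section

variable {n : ℕ}

/-- `E[|X·θ|^p]` for `X` uniform on `K`. -/
def absMoment (p : ℝ) (K : Set (EuclideanSpace ℝ (Fin n))) (θ : EuclideanSpace ℝ (Fin n)) : ℝ :=
  ∫ x, |inner ℝ x θ| ^ p ∂(unif K)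

theorem marginalNorm_eq (p : ℝ) (K : Set (EuclideanSpace ℝ (Fin n)))
    (θ : EuclideanSpace ℝ (Fin n)) : marginalNorm p K θ = absMoment p K θ ^ (1 / p) :=
  rfl

theorem absMoment_nonneg (p : ℝ) (K : Set (EuclideanSpace ℝ (Fin n)))
    (θ : EuclideanSpace ℝ (Fin n)) : 0 ≤ absMoment p K θ :=
  integral_nonneg fun _ => by positivity

theorem absMoment_smul (p : ℝ) (K : Set (EuclideanSpace ℝ (Fin n)))
    (θ : EuclideanSpace ℝ (Fin n)) {c : ℝ} (hc : 0 < c) :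
    absMoment p K (c • θ) = c ^ p * absMoment p K θ := by
  simp only [absMoment, real_inner_smul_right, abs_mul, abs_of_pos hc,
    Real.mul_rpow hc.le (abs_nonneg _), integral_const_mul]

theorem absMoment_neg (p : ℝ) (K : Set (EuclideanSpace ℝ (Fin n)))
    (θ : EuclideanSpace ℝ (Fin n)) : absMoment p K (-θ) = absMoment p K θ := by
  simp [absMoment, inner_neg_right]

theorem signedMoment_smul (q : ℝ) (K : Set (EuclideanSpace ℝ (Fin n)))
    (θ : EuclideanSpace ℝ (Fin n)) {c : ℝ} (hc : 0 < c) :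
    signedMoment q K (c • θ) = c ^ q * signedMoment q K θ := by
  have hs : ∀ t : ℝ, Real.sign (c * t) = Real.sign t := by
    intro t
    rcases lt_trichotomy t 0 with h | rfl | h
    · rw [Real.sign_of_neg h, Real.sign_of_neg (mul_neg_of_pos_of_neg hc h)]
    · simp
    · rw [Real.sign_of_pos h, Real.sign_of_pos (mul_pos hc h)]
  simp only [signedMoment, real_inner_smul_right, abs_mul, abs_of_pos hc, hs,
    Real.mul_rpow hc.le (abs_nonneg _), mul_assoc, integral_const_mul]

theorem signedMoment_neg (q : ℝ) (K : Set (EuclideanSpace ℝ (Fin n)))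
    (θ : EuclideanSpace ℝ (Fin n)) : signedMoment q K (-θ) = -signedMoment q K θ := by
  simp [signedMoment, inner_neg_right, Real.sign_neg, integral_neg]

theorem asymRatio_neg (p q : ℝ) (K : Set (EuclideanSpace ℝ (Fin n)))
    (θ : EuclideanSpace ℝ (Fin n)) : asymRatio p q K (-θ) = asymRatio p q K θ := by
  simp [asymRatio, marginalNorm_eq, absMoment_neg, signedMoment_neg]

theorem asymRatio_smul {p q : ℝ} (hp : 0 < p) (hq : 0 < q) (K : Set (EuclideanSpace ℝ (Fin n)))
    (θ : EuclideanSpace ℝ (Fin n)) {c : ℝ} (hc : 0 < c) :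
    asymRatio p q K (c • θ) = asymRatio p q K θ := by
  have h : ∀ r : ℝ, 0 < r → (c ^ r) ^ (1 / r) = c := fun r hr => by
    rw [← Real.rpow_mul hc.le, mul_one_div_cancel hr.ne', Real.rpow_one]
  rw [asymRatio, asymRatio, marginalNorm_eq, marginalNorm_eq, absMoment_smul p K θ hc,
    signedMoment_smul q K θ hc, abs_mul, abs_of_pos (Real.rpow_pos_of_pos hc q),
    Real.mul_rpow (by positivity) (abs_nonneg _),
    Real.mul_rpow (by positivity) (absMoment_nonneg p K θ), h p hp, h q hq,
    mul_div_mul_left _ _ hc.ne']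

theorem IsConvexBody.ae_unif_mem {K : Set (EuclideanSpace ℝ (Fin n))} (hK : IsConvexBody K) :
    ∀ᵐ x ∂(unif K), x ∈ K :=
  ProbabilityTheory.ae_cond_mem hK.isCompact.measurableSet

theorem IsConvexBody.integral_comp_inner {K : Set (EuclideanSpace ℝ (Fin n))}
    (hK : IsConvexBody K) {θ : EuclideanSpace ℝ (Fin n)} {M : ℝ}
    (hM : ∀ x ∈ K, |inner ℝ x θ| ≤ M) {ψ ψ' : ℝ → ℝ} (hψ : ∀ t, HasDerivAt ψ (ψ' t) t)
    (hψ' : Continuous ψ') :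
    ∫ x, ψ (inner ℝ x θ) ∂(unif K) = ψ (-M) + ∫ t in Set.Ioc (-M) M, ψ' t * tail K θ t := by
  have := hK.isProbabilityMeasure_unif
  refine integral_comp_eq_integral_tail (measurable_inner_right θ) ?_ hψ hψ'
  filter_upwards [hK.ae_unif_mem] with x hx using abs_le.1 (hM x hx)

theorem IsConvexBody.integral_inner_eq_zero {K : Set (EuclideanSpace ℝ (Fin n))}
    (hK : IsConvexBody K) (hK0 : IsCentered K) (θ : EuclideanSpace ℝ (Fin n)) :
    ∫ x, inner ℝ x θ ∂(unif K) = 0 := by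
  have := hK.isProbabilityMeasure_unif
  obtain ⟨C, hC⟩ := hK.isCompact.isBounded.exists_norm_le
  have hi : Integrable (fun x : EuclideanSpace ℝ (Fin n) => x) (unif K) := by
    refine Integrable.of_bound measurable_id.aestronglyMeasurable C ?_
    filter_upwards [hK.ae_unif_mem] with x hx using hC x hx
  simp_rw [real_inner_comm θ]
  rw [integral_inner hi θ, show ∫ x, x ∂(unif K) = 0 from hK0, inner_zero_right]

/-- A strict gap at `t` would persist on a one-sided neighbourhood, which meets the dense set of
points of equality. -/
theorem eq_of_antitone_of_ae_eq {f g : ℝ → ℝ} (hf : Antitone f) (hg : Continuous g) {M t : ℝ}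
    (ht : t ∈ Set.Ioo (-M) M)
    (h : ∀ᵐ s ∂(volume.restrict (Set.Ioc (-M) M)), f s - g s = 0) : f t = g t := by
  rw [ae_restrict_iff' measurableSet_Ioc] at h
  have hd := Measure.dense_of_ae h
  refine le_antisymm (le_of_not_gt fun hlt => ?_) (le_of_not_gt fun hlt => ?_)
  · have hev : ∀ᶠ s in nhdsWithin t (Set.Iio t), g s < f t :=
      (hg.continuousAt.eventually_lt continuousAt_const hlt).filter_mono nhdsWithin_le_nhds
    obtain ⟨u, hu, hus⟩ := (mem_nhdsLT_iff_exists_Ioo_subset' ht.1).1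
      (hev.and (Ioo_mem_nhdsLT ht.1))
    obtain ⟨s, hs, hsu⟩ := hd.exists_between hu
    have hs' := hus hsu
    have := hs ⟨hs'.2.1, hs'.2.2.le.trans ht.2.le⟩
    linarith [hf hsu.2.le, hs'.1]
  · have hev : ∀ᶠ s in nhdsWithin t (Set.Ioi t), f t < g s :=
      (continuousAt_const.eventually_lt hg.continuousAt hlt).filter_mono nhdsWithin_le_nhds
    obtain ⟨u, hu, hus⟩ := (mem_nhdsGT_iff_exists_Ioo_subset' ht.2).1
      (hev.and (Ioo_mem_nhdsGT ht.2))
    obtain ⟨s, hs, hsu⟩ := hd.exists_between hu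
    have hs' := hus hsu
    have := hs ⟨ht.1.trans hs'.2.1, hs'.2.2.le⟩
    linarith [hf hsu.1.le, hs'.1]

/-- Among centered bodies with prescribed `p`-th absolute moment, cones in the direction of their
apex maximize the signed `q`-th moment. -/
theorem IsConvexBody.signedMoment_le (hn : 1 ≤ n) {p q : ℝ} (hp : 1 < p) (hpq : p < q)
    {K C : Set (EuclideanSpace ℝ (Fin n))} (hK : IsConvexBody K) (hK0 : IsCentered K)
    (hC : IsConvexBody C) (hC0 : IsCentered C) {θ φ : EuclideanSpace ℝ (Fin n)} {a b : ℝ}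
    (hab : a < b) (hCt : ∀ t, tail C φ t = coneTail n a b t)
    (hm : absMoment p K θ = absMoment p C φ) :
    signedMoment q K θ ≤ signedMoment q C φ ∧
      (signedMoment q K θ = signedMoment q C φ → ∀ t, tail K θ t = coneTail n a b t) := by
  obtain ⟨MK, hMK⟩ := hK.exists_inner_bound θ
  obtain ⟨MC, hMC⟩ := hC.exists_inner_bound φ
  obtain ⟨t₁, t₂, h12, hl, hmid, hr⟩ := hK.exists_sign_pattern hn θ hab
  set D : ℝ → ℝ := fun t => tail K θ t - coneTail n a b t with hD
  have hDm : Measurable D :=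
    (hK.antitone_tail θ).measurable.sub (continuous_coneTail n a b).measurable
  have hD1 : ∀ t, |D t| ≤ 1 := fun t => by
    rw [abs_le]
    constructor <;> simp only [hD] <;>
      linarith [tail_nonneg K θ t, hK.tail_le_one θ t, coneTail_nonneg n a b t,
        coneTail_le_one n a b t]
  -- A common window makes the boundary terms `ψ(-M)` cancel. The identity is used for `|t|^q sgn t`
  -- (the target), `t` (centering) and `|t|^p` (matched moments).
  have diff : ∀ M, MK ≤ M → MC ≤ M → ∀ ψ ψ' : ℝ → ℝ, (∀ t, HasDerivAt ψ (ψ' t) t) →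
      Continuous ψ' → ∫ x, ψ (inner ℝ x θ) ∂(unif K) - ∫ x, ψ (inner ℝ x φ) ∂(unif C) =
        ∫ t in Set.Ioc (-M) M, ψ' t * D t := by
    intro M h1 h2 ψ ψ' hψ hψ'
    have hint : ∀ g : ℝ → ℝ, Measurable g → (∀ t, 0 ≤ g t) → (∀ t, g t ≤ 1) →
        Integrable (fun t => ψ' t * g t) (volume.restrict (Set.Ioc (-M) M)) := by
      intro g hg hg0 hg1
      refine Integrable.mul_bdd (c := 1) ?_ hg.aestronglyMeasurable
        (Filter.Eventually.of_forall fun t => by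
          rw [Real.norm_of_nonneg (hg0 t)]; exact hg1 t)
      exact (hψ'.continuousOn.integrableOn_compact isCompact_Icc).mono_set Set.Ioc_subset_Icc_self
    rw [hK.integral_comp_inner (fun x hx => (hMK x hx).trans h1) hψ hψ',
      hC.integral_comp_inner (fun x hx => (hMC x hx).trans h2) hψ hψ', add_sub_add_left_eq_sub]
    simp_rw [hCt]
    rw [← integral_sub (hint _ (hK.antitone_tail θ).measurable (tail_nonneg K θ)
        (hK.tail_le_one θ))
      (hint _ (continuous_coneTail n a b).measurable (coneTail_nonneg n a b)
        (coneTail_le_one n a b))]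
    simp_rw [hD, mul_sub]
  have main : ∀ M, MK ≤ M → MC ≤ M →
      signedMoment q K θ - signedMoment q C φ = q * ∫ t in Set.Ioc (-M) M, |t| ^ (q - 1) * D t ∧
      ∫ t in Set.Ioc (-M) M, |t| ^ (q - 1) * D t ≤ 0 ∧
      (∫ t in Set.Ioc (-M) M, |t| ^ (q - 1) * D t = 0 →
        ∀ᵐ t ∂(volume.restrict (Set.Ioc (-M) M)), D t = 0) := by
    intro M h1 h2
    refine ⟨?_, integral_abs_rpow_mul_le_zero hp hpq hDm hD1 h12 hl hmid hr ?_ ?_⟩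
    · have := diff M h1 h2 (fun t => |t| ^ q * Real.sign t) (fun t => q * |t| ^ (q - 1))
        (hasDerivAt_abs_rpow_mul_sign (by linarith))
        (continuous_const.mul (continuous_abs.rpow_const fun _ => Or.inr (by linarith)))
      simpa only [signedMoment, mul_assoc, integral_const_mul] using this
    · have := diff M h1 h2 (fun t => t) (fun _ => 1) (fun t => hasDerivAt_id t) continuous_const
      rw [hK.integral_inner_eq_zero hK0, hC.integral_inner_eq_zero hC0] at this
      simpa using this.symm
    · have := diff M h1 h2 (fun t => |t| ^ p) (fun t => p * (|t| ^ (p - 2) * t))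
        (fun t => by simpa only [mul_assoc] using hasDerivAt_abs_rpow t hp)
        (continuous_const.mul (continuous_abs_rpow_mul hp))
      rw [show ∫ x, |inner ℝ x θ| ^ p ∂(unif K) = ∫ x, |inner ℝ x φ| ^ p ∂(unif C) from hm,
        sub_self] at this
      simp only [mul_assoc, integral_const_mul] at this
      have h0 := (mul_eq_zero.1 this.symm).resolve_left (by linarith)
      simpa only [mul_assoc] using h0
  have hq : 0 < q := by linarith
  refine ⟨?_, fun heq t => ?_⟩
  · obtain ⟨e, hle, -⟩ := main (max MK MC) (le_max_left _ _) (le_max_right _ _)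
    nlinarith
  -- The window is enlarged to have the given `t` in its interior.
  · set M := max (max MK MC) (|t| + 1) with hM
    obtain ⟨e, -, hz⟩ := main M ((le_max_left _ _).trans (le_max_left _ _))
      ((le_max_right _ _).trans (le_max_left _ _))
    rw [heq, sub_self] at e
    have htM : |t| < M := (lt_add_one _).trans_le (le_max_right _ _)
    exact eq_of_antitone_of_ae_eq (hK.antitone_tail θ) (continuous_coneTail n a b) (abs_lt.1 htM)
      (hz ((mul_eq_zero.1 e.symm).resolve_left hq.ne'))

theorem IsConvexBody.continuous_integral {K : Set (EuclideanSpace ℝ (Fin n))}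
    (hK : IsConvexBody K) {ψ : ℝ → ℝ} (hψ : Continuous ψ) :
    Continuous fun θ : EuclideanSpace ℝ (Fin n) => ∫ x, ψ (inner ℝ x θ) ∂(unif K) := by
  simp only [unif, ProbabilityTheory.cond, integral_smul_measure]
  have h : Continuous fun θ : EuclideanSpace ℝ (Fin n) => ∫ x in K, ψ (inner ℝ x θ) :=
    continuous_parametric_integral_of_continuous
      (f := fun (θ x : EuclideanSpace ℝ (Fin n)) => ψ (inner ℝ x θ))
      (hψ.comp (continuous_snd.inner continuous_fst)) hK.isCompact
  exact continuous_const.mul h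

theorem continuous_abs_rpow {p : ℝ} (hp : 1 < p) : Continuous fun t : ℝ => |t| ^ p :=
  continuous_abs.rpow_const fun _ => Or.inr (by linarith)

/-- A body with nonempty interior is not contained in the hyperplane orthogonal to `θ`. -/
theorem IsConvexBody.absMoment_pos {p : ℝ} (hp : 1 < p) {K : Set (EuclideanSpace ℝ (Fin n))}
    (hK : IsConvexBody K) {θ : EuclideanSpace ℝ (Fin n)} (hθ : θ ≠ 0) : 0 < absMoment p K θ := by
  have := hK.isProbabilityMeasure_unif
  have hcont : Continuous fun x : EuclideanSpace ℝ (Fin n) => (inner ℝ x θ : ℝ) :=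
    continuous_id.inner continuous_const
  obtain ⟨M, hM⟩ := hK.exists_inner_bound θ
  have hi : Integrable (fun x => |(inner ℝ x θ : ℝ)| ^ p) (unif K) := by
    refine Integrable.of_bound
      ((continuous_abs_rpow hp).comp hcont).aestronglyMeasurable (M ^ p) ?_
    filter_upwards [hK.ae_unif_mem] with x hx
    rw [Real.norm_of_nonneg (by positivity)]
    exact Real.rpow_le_rpow (abs_nonneg _) (hM x hx) (by linarith)
  rw [absMoment, integral_pos_iff_support_of_nonneg (fun x => by positivity) hi]
  have hsupp : Function.support (fun x => |(inner ℝ x θ : ℝ)| ^ p) = {x | inner ℝ x θ ≠ 0} := by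
    ext x
    simp [(by linarith : p ≠ 0)]
  have hU : IsOpen {x : EuclideanSpace ℝ (Fin n) | (inner ℝ x θ : ℝ) ≠ 0} :=
    isOpen_ne_fun hcont continuous_const
  have hne : (K ∩ {x | (inner ℝ x θ : ℝ) ≠ 0}).Nonempty := by
    by_contra h0
    have hsub : K ⊆ ((Submodule.span ℝ {θ})ᗮ : Submodule ℝ (EuclideanSpace ℝ (Fin n))) := by
      intro x hx
      rw [SetLike.mem_coe, Submodule.mem_orthogonal_singleton_iff_inner_left]
      by_contra hx0
      exact h0 ⟨x, hx, hx0⟩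
    refine hK.volume_ne_zero (measure_mono_null hsub (Measure.addHaar_submodule _ _ fun htop => ?_))
    have : θ ∈ (Submodule.span ℝ {θ})ᗮ := htop ▸ Submodule.mem_top
    rw [Submodule.mem_orthogonal_singleton_iff_inner_left] at this
    exact hθ (inner_self_eq_zero.1 this)
  have hpos := hK.volume_real_inter_pos hU hne
  rw [hsupp, unif, ProbabilityTheory.cond_apply hK.isCompact.measurableSet]
  refine ENNReal.mul_pos (ENNReal.inv_ne_zero.2 hK.isCompact.measure_lt_top.ne) ?_
  intro h0
  simp [Measure.real, h0] at hpos

theorem IsConvexBody.continuousOn_asymRatio {p q : ℝ} (hp : 1 < p) (hpq : p < q)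
    {K : Set (EuclideanSpace ℝ (Fin n))} (hK : IsConvexBody K) :
    ContinuousOn (asymRatio p q K) (Metric.sphere 0 1) := by
  have h1 : Continuous (absMoment p K) := hK.continuous_integral (continuous_abs_rpow hp)
  have h2 : Continuous (signedMoment q K) := by
    refine hK.continuous_integral (ψ := fun t => |t| ^ q * Real.sign t) ?_
    exact continuous_iff_continuousAt.2 fun t =>
      (hasDerivAt_abs_rpow_mul_sign (by linarith) t).continuousAt
  have hq : 0 ≤ 1 / q := one_div_nonneg.2 (by linarith)
  have hp' : 0 ≤ 1 / p := by positivity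
  refine ContinuousOn.div (h2.abs.rpow_const fun _ => Or.inr hq).continuousOn
    (h1.rpow_const fun _ => Or.inr hp').continuousOn fun θ hθ => ?_
  have hθ0 : θ ≠ 0 := by
    rintro rfl; simp at hθ
  exact (Real.rpow_pos_of_pos (hK.absMoment_pos hp hθ0) _).ne'

/-- The cone is extremal in the direction of its apex, and only cones are extremal. -/
theorem IsConvexBody.asymRatio_le (hn : 1 ≤ n) {p q : ℝ} (hp : 1 < p) (hpq : p < q)
    {K C : Set (EuclideanSpace ℝ (Fin n))} (hK : IsConvexBody K) (hK0 : IsCentered K)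
    (hC : IsConvexBody C) (hC0 : IsCentered C) {θ φ : EuclideanSpace ℝ (Fin n)} {a b : ℝ}
    (hab : a < b) (hCt : ∀ t, tail C φ t = coneTail n a b t) (hθ : θ ≠ 0) (hφ : φ ≠ 0) :
    asymRatio p q K θ ≤ asymRatio p q C φ ∧
      (asymRatio p q K θ = asymRatio p q C φ → ∃ B, IsConeWithBase K B ∧ IsNormalTo θ B) := by
  -- The ratio is even in `θ` and the signed moment is odd, so a one-sided bound on the signed
  -- moment suffices.
  wlog hs : 0 ≤ signedMoment q K θ generalizing θ
  · have := this (neg_ne_zero.2 hθ) (by rw [signedMoment_neg]; linarith)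
    rw [asymRatio_neg] at this
    refine ⟨this.1, fun h => ?_⟩
    obtain ⟨B, hB, hBn⟩ := this.2 h
    exact ⟨B, hB, by simpa [IsNormalTo] using hBn⟩
  have hp0 : 0 < p := by linarith
  have hq0 : 0 < q := by linarith
  have hAK := hK.absMoment_pos hp hθ
  have hAC := hC.absMoment_pos hp hφ
  -- The ratio is invariant under positive scaling of `θ`; this factor equalizes the `p`-th moments,
  -- hence the denominators.
  set c := (absMoment p C φ / absMoment p K θ) ^ (1 / p) with hc
  have hc0 : 0 < c := Real.rpow_pos_of_pos (div_pos hAC hAK) _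
  have hcp : c ^ p = absMoment p C φ / absMoment p K θ := by
    rw [hc, ← Real.rpow_mul (div_pos hAC hAK).le, one_div_mul_cancel hp0.ne', Real.rpow_one]
  have hm : absMoment p K (c • θ) = absMoment p C φ := by
    rw [absMoment_smul p K θ hc0, hcp, div_mul_cancel₀ _ hAK.ne']
  obtain ⟨hle, heq⟩ := hK.signedMoment_le hn hp hpq hK0 hC hC0 hab hCt hm
  have hs' : 0 ≤ signedMoment q K (c • θ) := by
    rw [signedMoment_smul q K θ hc0]; positivity
  have hN : 0 < absMoment p C φ ^ (1 / p) := Real.rpow_pos_of_pos hAC _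
  rw [← asymRatio_smul hp0 hq0 K θ hc0, asymRatio, asymRatio, marginalNorm_eq, marginalNorm_eq, hm,
    abs_of_nonneg hs', abs_of_nonneg (hs'.trans hle)]
  refine ⟨by gcongr, fun h => ?_⟩
  have h1 := (div_left_inj' hN.ne').1 h
  rw [Real.rpow_left_inj hs' (hs'.trans hle) (by positivity)] at h1
  obtain ⟨B, hB, hBn⟩ := hK.exists_isConeWithBase_of_tail_eq hn (smul_ne_zero hc0.ne' hθ) hab
    (heq h1)
  exact ⟨B, hB, (Submodule.smul_mem_iff _ hc0.ne').1 hBn⟩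

theorem IsConvexBody.isGreatest_alphaStar (hn : 1 ≤ n) {p q : ℝ} (hp : 1 < p) (hpq : p < q)
    {K : Set (EuclideanSpace ℝ (Fin n))} (hK : IsConvexBody K) :
    IsGreatest (asymRatio p q K '' Metric.sphere 0 1) (alphaStar p q K) := by
  have : NeZero n := ⟨by omega⟩
  exact ((isCompact_sphere _ _).image_of_continuousOn
    (hK.continuousOn_asymRatio hp hpq)).isGreatest_sSup
    ((NormedSpace.sphere_nonempty.2 zero_le_one).image _)

/-- Comparing the cone with itself: no direction beats the one normal to a base. -/
theorem IsConvexBody.exists_alphaStar_eq_asymRatio_of_isCone (hn : 1 ≤ n) {p q : ℝ}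
    (hp : 1 < p) (hpq : p < q)
    {C : Set (EuclideanSpace ℝ (Fin n))} (hC : IsConvexBody C) (hC0 : IsCentered C)
    (hCc : IsCone C) :
    ∃ φ : EuclideanSpace ℝ (Fin n), φ ≠ 0 ∧ alphaStar p q C = asymRatio p q C φ ∧
      ∃ a b : ℝ, a < b ∧ ∀ t, tail C φ t = coneTail n a b t := by
  obtain ⟨B, hB⟩ := hCc
  obtain ⟨φ, hφ, a, b, hab, ht⟩ := hB.exists_tail_eq hn hC
  refine ⟨φ, hφ, ?_, a, b, hab, ht⟩
  obtain ⟨⟨θ, hθ, hθe⟩, hub⟩ := hC.isGreatest_alphaStar hn hp hpq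
  have hθ0 : θ ≠ 0 := by
    rintro rfl; simp at hθ
  refine le_antisymm ?_ ?_
  · rw [← hθe]
    exact (hC.asymRatio_le hn hp hpq hC0 hC hC0 hab ht hθ0 hφ).1
  · have hnorm : 0 < ‖φ‖ := norm_pos_iff.2 hφ
    rw [← asymRatio_smul (by linarith) (by linarith) C φ (inv_pos.2 hnorm)]
    refine hub ⟨_, ?_, rfl⟩
    simp [norm_smul, hnorm.ne']

end

theorem theorem10 {n : ℕ} (hn : 1 ≤ n) {p q : ℝ} (hp : 1 < p) (hpq : p < q)
    (D : Set (EuclideanSpace ℝ (Fin n))) (hD : IsSimplex D) (hD0 : IsCentered D)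
    (K : Set (EuclideanSpace ℝ (Fin n))) (hK : IsConvexBody K) (hK0 : IsCentered K) :
    IsGreatest (asymRatio p q K '' Metric.sphere 0 1) (alphaStar p q K) ∧
    alphaStar p q K ≤ alphaStar p q D ∧
    (alphaStar p q K = alphaStar p q D ↔ IsCone K) ∧
    (IsCone K → ∀ θ ∈ Metric.sphere (0 : EuclideanSpace ℝ (Fin n)) 1,
      asymRatio p q K θ = alphaStar p q K → ∃ B, IsConeWithBase K B ∧ IsNormalTo θ B) := by
  have hDb := hD.isConvexBody
  obtain ⟨φ, hφ, hφe, a, b, hab, ht⟩ :=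
    hDb.exists_alphaStar_eq_asymRatio_of_isCone hn hp hpq hD0 (hD.isCone hn)
  have hgr := hK.isGreatest_alphaStar hn hp hpq
  have hne : ∀ θ ∈ Metric.sphere (0 : EuclideanSpace ℝ (Fin n)) 1, θ ≠ 0 := by
    rintro θ hθ rfl; simp at hθ
  have hcomp : ∀ θ ∈ Metric.sphere (0 : EuclideanSpace ℝ (Fin n)) 1,
      asymRatio p q K θ ≤ alphaStar p q D ∧ (asymRatio p q K θ = alphaStar p q D →
        ∃ B, IsConeWithBase K B ∧ IsNormalTo θ B) := fun θ hθ => by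
    rw [hφe]
    exact hK.asymRatio_le hn hp hpq hK0 hDb hD0 hab ht (hne θ hθ) hφ
  obtain ⟨θ₀, hθ₀, hθ₀e⟩ := hgr.1
  have hle : alphaStar p q K ≤ alphaStar p q D := hθ₀e ▸ (hcomp θ₀ hθ₀).1
  have heq : IsCone K → alphaStar p q K = alphaStar p q D := by
    intro hKc
    obtain ⟨ψ, hψ, hψe, a', b', hab', ht'⟩ :=
      hK.exists_alphaStar_eq_asymRatio_of_isCone hn hp hpq hK0 hKc
    -- The comparison with the roles exchanged: now the cone `K` is the extremal body and the
    -- simplex the competitor.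
    refine le_antisymm hle ?_
    rw [hφe, hψe]
    exact (hDb.asymRatio_le hn hp hpq hD0 hK hK0 hab' ht' hφ hψ).1
  refine ⟨hgr, hle, ⟨fun h => ?_, heq⟩, fun hKc θ hθ h => (hcomp θ hθ).2 (h.trans (heq hKc))⟩
  obtain ⟨B, hB, -⟩ := (hcomp θ₀ hθ₀).2 (hθ₀e.trans h)
  exact ⟨B, hB⟩
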